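/- All groups carry word metrics with respect to finite generating sets (i.e. they are identified with the vertex sets of their Cayley graphs); $\partial\Gamma$ denotes the geodesic boundary of a hyperbolic group $\Gamma$, and for $A\subset \Gamma$, $\Lambda_\Gamma(A)\subset\partial \Gamma$ is the set of accumulation points of $A$ in $\partial \Gamma$. A map $f:Y\to X$ of hyperbolic spaces admits a Cannon–Thurston (CT) map if there is a continuous map $\partial f:\partial Y\to\partial X$ such that $y_n\to\xi\in\partial Y$ implies $f(y_n)\to\partial f(\xi)$. In that case a leaf of the CT lamination $\mathcal L_X(Y)$ is a (quasi)geodesic line $\alpha$ in $Y$ with $\alpha(-\infty)\ne\alpha(\infty)$ and $\partial f(\alpha(-\infty))=\partial f(\alpha(\infty))$; a leaf is carried (or supported) by a qi embedded subset $Z\subset Y$ if it lies in a finite neighbourhood of $Z$ in $Y$. A finitely generated subgroup $H$ of $G$ is distorted in $G$ if its distortion function $R\mapsto \mathrm{Diam}_H\{h\in H: d_G(1,h)\le R\}$ is not bounded above by a linear (affine) function. **Corollary.** Let $G$ be a hyperbolic group and $G_1<G$ a hyperbolic subgroup such that the inclusion $G_1\to G$ admits a CT map. Let $H,K$ be hyperbolic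 subgroups of $G_1$ such that (i) the inclusion $K\to G_1$ admits a CT map; (ii) $\Lambda_{G_1}(K)=\partial G_1$; (iii) $H$ is qi (quasi-isometrically) embedded in $G_1$ and $[G_1:H]=\infty$; (iv) $H$ is not qi embedded in $G$. Then the inclusion $H\to G$ admits a CT map, and for every leaf $\alpha$ of the CT lamination $\mathcal L_G(H)$ which is contained in a finite neighbourhood of $K$ (in a Cayley graph of $G$) there is a finitely generated subgroup $K_1$ of $H\cap K$ such that: (1) $\alpha$ is contained in a finite neighbourhood of $K_1$ (in a Cayley graph of $G$); (2) $\Lambda_K(K_1)\neq\partial K$, and in particular $[K:K_1]=\infty$; (3) $K_1$ is not qi embedded in $G$, i.e. $K_1$ is distorted in $G$; (4) if $K_1$ is qi embedded in $K$, then the inclusion $K\to G$ admits a CT map and $K_1$ carries a leaf of the CT lamination $\mathcal L_G(K)$. -/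

import Mathlib

open Set Filter Topology

universe u v

namespace CT

/-! ### Word metrics -/

/-- A finite generating set of a group. -/
structure FiniteGeneratingSet (G : Type u) [Group G] where
  /-- the generators -/
  carrier : Finset G
  closure_eq_top : Subgroup.closure (carrier : Set G) = ⊤

/-- The group `G`, regarded as the vertex set of its Cayley graph with respect to `S`; it carries
the word metric of `S`. -/
def Cay {G : Type u} [Group G] (_S : FiniteGeneratingSet G) : Type u := G

/-- The Cayley graph of `G` with respect to `S`: the vertices `g ≠ h` are adjacent iff
`h = g * s` or `g = h * s` for some `s ∈ S`. -/
def Cay.graph {G : Type u} [Group G] (S : FiniteGeneratingSet G) : SimpleGraph (Cay S) :=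
  SimpleGraph.mulCayley (M := G) (S.carrier : Set G)

theorem Cay.graph_connected {G : Type u} [Group G] (S : FiniteGeneratingSet G) :
    (Cay.graph S).Connected := by
  have step : ∀ (g s : G), s ∈ (S.carrier : Set G) →
      (SimpleGraph.mulCayley (S.carrier : Set G)).Reachable g (g * s) := by
    intro g s hs
    by_cases h : g = g * s
    · rw [← h]
    · exact SimpleGraph.Adj.reachable
        ((SimpleGraph.mulCayley_adj' _ _ _).2 ⟨h, s, hs, Or.inl rfl⟩)
  have key : ∀ x : G, ∀ g : G,
      (SimpleGraph.mulCayley (S.carrier : Set G)).Reachable g (g * x) := by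
    intro x
    have hx : x ∈ Subgroup.closure (S.carrier : Set G) := by
      rw [S.closure_eq_top]; exact Subgroup.mem_top x
    induction hx using Subgroup.closure_induction with
    | mem s hs => exact fun g => step g s hs
    | one => intro g; rw [mul_one]
    | mul a b _ _ iha ihb =>
      intro g
      rw [← mul_assoc]
      exact (iha g).trans (ihb (g * a))
    | inv a _ iha =>
      intro g
      have h := (iha (g * a⁻¹)).symm
      rwa [inv_mul_cancel_right] at h
  have key' : ∀ g h : G, (SimpleGraph.mulCayley (S.carrier : Set G)).Reachable g h := by
    intro g h
    have := key (g⁻¹ * h) g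
    rwa [mul_inv_cancel_left] at this
  have : Nonempty (Cay S) := ⟨(1 : G)⟩
  exact ⟨fun g h => key' g h⟩

/-- The word metric: the path metric of the Cayley graph on its vertices. -/
noncomputable instance {G : Type u} [Group G] (S : FiniteGeneratingSet G) :
    MetricSpace (Cay S) where
  dist x y := ((Cay.graph S).dist x y : ℝ)
  dist_self x := by simp
  dist_comm x y := by simp [SimpleGraph.dist_comm]
  dist_triangle x y z := by exact_mod_cast (Cay.graph_connected S).dist_triangle
  eq_of_dist_eq_zero {x y} h :=
    (Cay.graph_connected S).dist_eq_zero_iff.1 (by exact_mod_cast h)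

/-- A group homomorphism (below: always an inclusion of subgroups), regarded as a map between the
vertex sets of Cayley graphs. -/
def Cay.map {G : Type u} {H : Type v} [Group G] [Group H] (f : H →* G)
    (T : FiniteGeneratingSet H) (S : FiniteGeneratingSet G) : Cay T → Cay S :=
  fun x => f x

/-- A subset of the group, regarded as a set of vertices of its Cayley graph. -/
def Cay.subset {G : Type u} [Group G] (S : FiniteGeneratingSet G) (A : Set G) : Set (Cay S) := A

/-! ### Coarse geometry

In this part the metric spaces are meant to be vertex sets of connected graphs with the path
metric (such as `Cay S`), so geodesics are parametrized by integers. -/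

/-- Quasi-isometric embeddings. -/
def IsQIEmbedding {X : Type u} {Y : Type v} [MetricSpace X] [MetricSpace Y] (f : X → Y) : Prop :=
  ∃ k : ℝ, 1 ≤ k ∧ ∀ x x' : X,
    k⁻¹ * dist x x' - k ≤ dist (f x) (f x') ∧ dist (f x) (f x') ≤ k * dist x x' + k

/-- `c 0, c 1, …, c n` is a geodesic from `x` to `y`. -/
def IsGeodesic {X : Type u} [MetricSpace X] (c : ℕ → X) (n : ℕ) (x y : X) : Prop :=
  c 0 = x ∧ c n = y ∧ ∀ i ≤ n, ∀ j ≤ n, dist (c i) (c j) = |(i : ℝ) - (j : ℝ)|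

/-- Hyperbolicity: for some `δ`, each side `[x, y]` of a geodesic triangle lies in the
`δ`-neighbourhood of the union of the other two sides `[y, z]` and `[x, z]`. -/
def IsHyperbolic (X : Type u) [MetricSpace X] : Prop :=
  ∃ δ : ℝ, ∀ (x y z : X) (a b c : ℕ → X) (l m n : ℕ),
    IsGeodesic a l x y → IsGeodesic b m y z → IsGeodesic c n x z →
      ∀ i ≤ l, (∃ j ≤ m, dist (a i) (b j) ≤ δ) ∨ (∃ j ≤ n, dist (a i) (c j) ≤ δ)

/-- Geodesic rays. -/
def GeodesicRay (X : Type u) [MetricSpace X] : Type u := {c : ℕ → X // Isometry c}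

/-- Two geodesic rays are equivalent iff their Hausdorff distance is finite. -/
def rayEquiv (X : Type u) [MetricSpace X] : Setoid (GeodesicRay X) where
  r c c' := Metric.hausdorffEDist (range c.1) (range c'.1) ≠ ⊤
  iseqv :=
    { refl := fun c => by simp [Metric.hausdorffEDist_self]
      symm := fun {c c'} h => by rwa [Metric.hausdorffEDist_comm]
      trans := fun {a b c} h h' =>
        ne_top_of_le_ne_top (ENNReal.add_ne_top.2 ⟨h, h'⟩) Metric.hausdorffEDist_triangle }

/-- The geodesic boundary `∂X`. -/
def Boundary (X : Type u) [MetricSpace X] : Type u := Quotient (rayEquiv X)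

/-- `X̄ = X ∪ ∂X`. -/
inductive Compactification (X : Type u) [MetricSpace X] : Type u
  /-- the points of `X` -/
  | pt (x : X) : Compactification X
  /-- the points of `∂X` -/
  | bdry (ξ : Boundary X) : Compactification X

/-- The Gromov product `(x | y)_o`. -/
noncomputable def gromovProduct {X : Type u} [MetricSpace X] (o x y : X) : ℝ :=
  (dist x o + dist y o - dist x y) / 2

/-- The basic neighbourhood of radius `r` (seen from `o`) of a boundary point `ξ` in `X ∪ ∂X`: the
points `x` with `(c i | x)_o ≥ r` for large `i`, for some ray `c` in the class `ξ`, and the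
boundary points `η` with `(c i | c' j)_o ≥ r` for large `i, j`, for some rays `c` in the class `ξ`
and `c'` in the class `η`. -/
def basicNhd {X : Type u} [MetricSpace X] (o : X) (r : ℝ) (ξ : Boundary X) :
    Set (Compactification X) :=
  {p | match p with
    | .pt x => ∃ c : GeodesicRay X, Quotient.mk (rayEquiv X) c = ξ ∧
        ∃ N : ℕ, ∀ i ≥ N, r ≤ gromovProduct o (c.1 i) x
    | .bdry η => ∃ c c' : GeodesicRay X, Quotient.mk (rayEquiv X) c = ξ ∧
        Quotient.mk (rayEquiv X) c' = η ∧
        ∃ N : ℕ, ∀ i ≥ N, ∀ j ≥ N, r ≤ gromovProduct o (c.1 i) (c'.1 j)}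

theorem basicNhd_anti {X : Type u} [MetricSpace X] (o : X) (ξ : Boundary X) {r r' : ℝ}
    (h : r ≤ r') : basicNhd o r' ξ ⊆ basicNhd o r ξ := by
  rintro (x | η) hp
  · obtain ⟨c, hc, N, hN⟩ := hp
    exact ⟨c, hc, N, fun i hi => h.trans (hN i hi)⟩
  · obtain ⟨c, c', hc, hc', N, hN⟩ := hp
    exact ⟨c, c', hc, hc', N, fun i hi j hj => h.trans (hN i hi j hj)⟩

/-- The topology of `X ∪ ∂X`: the points of (the discrete space) `X` are isolated, and the sets
`basicNhd o r ξ`, `r : ℝ`, form a neighbourhood basis at `ξ ∈ ∂X`. In a hyperbolic space this does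
not depend on the base point `o`. -/
instance (X : Type u) [MetricSpace X] : TopologicalSpace (Compactification X) where
  IsOpen U := ∀ (o : X) (ξ : Boundary X), Compactification.bdry ξ ∈ U →
    ∃ r : ℝ, basicNhd o r ξ ⊆ U
  isOpen_univ := fun _ _ _ => ⟨0, subset_univ _⟩
  isOpen_inter := fun U V hU hV o ξ hξ => by
    obtain ⟨r, hr⟩ := hU o ξ hξ.1
    obtain ⟨s, hs⟩ := hV o ξ hξ.2
    exact ⟨max r s, subset_inter ((basicNhd_anti o ξ (le_max_left r s)).trans hr)
      ((basicNhd_anti o ξ (le_max_right r s)).trans hs)⟩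
  isOpen_sUnion := fun 𝒰 h o ξ hξ => by
    obtain ⟨U, hU, hξU⟩ := hξ
    obtain ⟨r, hr⟩ := h U hU o ξ hξU
    exact ⟨r, hr.trans (subset_sUnion_of_mem hU)⟩

/-- The subspace topology of `∂X ⊆ X ∪ ∂X`. -/
instance (X : Type u) [MetricSpace X] : TopologicalSpace (Boundary X) :=
  TopologicalSpace.induced Compactification.bdry inferInstance

/-- The limit set `Λ_X(A)`: the accumulation points of `A` in `∂X`. -/
def limitSet {X : Type u} [MetricSpace X] (A : Set X) : Set (Boundary X) :=
  {ξ | AccPt (Compactification.bdry ξ) (𝓟 (Compactification.pt '' A))}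

/-- The quasigeodesic ray `a` ends at `ξ`, that is `a(∞) = ξ`. -/
def EndsAt {X : Type u} [MetricSpace X] (a : ℕ → X) (ξ : Boundary X) : Prop :=
  ∃ c : GeodesicRay X, Quotient.mk (rayEquiv X) c = ξ ∧
    Metric.hausdorffEDist (range a) (range c.1) ≠ ⊤

/-- `F : ∂Y → ∂X` is a Cannon–Thurston map of `f : Y → X`: it is continuous, and `yₙ → ξ ∈ ∂Y`
implies `f yₙ → F ξ`. -/
def IsCTMap {Y : Type u} {X : Type v} [MetricSpace Y] [MetricSpace X] (f : Y → X)
    (F : Boundary Y → Boundary X) : Prop :=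
  Continuous F ∧ ∀ (ξ : Boundary Y) (y : ℕ → Y),
    Tendsto (fun n => Compactification.pt (y n)) atTop (𝓝 (Compactification.bdry ξ)) →
      Tendsto (fun n => Compactification.pt (f (y n))) atTop (𝓝 (Compactification.bdry (F ξ)))

/-- `f` admits a Cannon–Thurston map. -/
def AdmitsCTMap {Y : Type u} {X : Type v} [MetricSpace Y] [MetricSpace X] (f : Y → X) : Prop :=
  ∃ F : Boundary Y → Boundary X, IsCTMap f F

/-- The Cannon–Thurston lamination of a map `f : Y → X` with Cannon–Thurston map `F`. -/
def CTLamination {Y : Type u} {X : Type v} [MetricSpace Y] [MetricSpace X]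
    (F : Boundary Y → Boundary X) : Set (Boundary Y × Boundary Y) :=
  {p | p.1 ≠ p.2 ∧ F p.1 = F p.2}

/-- `α` is a leaf of the Cannon–Thurston lamination of `f : Y → X`: `f` admits a Cannon–Thurston
map, and `α` is a (quasi)geodesic line in `Y` such that `(α(-∞), α(∞))` is in the lamination. -/
def IsLeaf {Y : Type u} {X : Type v} [MetricSpace Y] [MetricSpace X] (f : Y → X) (α : ℤ → Y) :
    Prop :=
  ∃ F : Boundary Y → Boundary X, IsCTMap f F ∧ IsQIEmbedding α ∧
    ∃ p ∈ CTLamination F,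
      EndsAt (fun n : ℕ => α (-(n : ℤ))) p.1 ∧ EndsAt (fun n : ℕ => α (n : ℤ)) p.2

/-- The line `α` lies in a finite neighbourhood of `A`. -/
def LiesNear {X : Type u} [MetricSpace X] (α : ℤ → X) (A : Set X) : Prop :=
  ∃ D : ℝ, ∀ n : ℤ, ∃ a ∈ A, dist (α n) a ≤ D

/-! ### Distortion -/

/-- The distortion function of (the image of) an injective homomorphism `i : H → G`: the diameter,
in the word metric of `H`, of the set of elements of `H` that lie in the ball of radius `R` about
`1` in `G`. -/
noncomputable def distortion {G : Type u} {H : Type v} [Group G] [Group H] (i : H →* G)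
    (T : FiniteGeneratingSet H) (S : FiniteGeneratingSet G) (R : ℕ) : ℝ :=
  Metric.diam {h : Cay T | dist (Cay.map i T S h) ((1 : G) : Cay S) ≤ R}

/-- `H` is distorted in `G`: the distortion function is not bounded above by any linear (affine)
function. -/
def IsDistorted {G : Type u} {H : Type v} [Group G] [Group H] (i : H →* G)
    (T : FiniteGeneratingSet H) (S : FiniteGeneratingSet G) : Prop :=
  ∀ C : ℝ, ∃ R : ℕ, C * R + C < distortion i T S R

end CT

/-!
The leaf `α` runs in `H` and stays, in `G`, close to `K`. Pick `a n ∈ K` close to `α n`. The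
differences `(α n)⁻¹ * a n` take finitely many values, and whenever two of them agree, `α n` and
`α m` differ by left multiplication with an element of `H ⊓ K`. So `α` stays close, even in the word
metric of `H`, to a sequence `u` in `H ⊓ K`; its increments have bounded length, so `u` lies in a
finitely generated subgroup `K₁` (`exists_fg_subgroup_near`). As `u` is close to the quasigeodesic
`α`, it is a quasigeodesic line of `K₁`, for every finite generating set
(`isQIEmbedding_of_dist_le`).

In `G` both ends of `u` converge to the common image of the ends of the leaf, whereas the ends of a
quasigeodesic line are distinct (`IsQIEmbedding.ends_ne`). Hence `K₁` is not quasi-isometrically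
embedded in `G`, and then it is distorted (`isDistorted_of_not_isQIEmbedding`). If it is
quasi-isometrically embedded in `K`, then `u` is a quasigeodesic line of `K`, and it is a leaf.

If `K₁` had full limit set in `∂K`, then `K₁`, and therefore `H`, would have full limit set in `∂G₁`,
since the Cannon–Thurston map `∂K → ∂G₁` is onto (`limitSet_eq_univ_of_admitsCTMap`). Through every
`g ∈ G₁` there is a geodesic line (`Cay.exists_line`); both of its ends would be limits of elements
of the quasiconvex subgroup `H`, so `g` would be close to `H`
(`exists_forall_dist_le_of_limitSet_eq_univ`), which contradicts the infinite index.

The tools from hyperbolic geometry are the four-point inequality for Gromov products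
(`IsHyperbolic.exists_fourPoint`), the stability of quasigeodesics
(`exists_geodesic_near_quasiGeodesic`, `exists_quasiGeodesic_near_geodesic`), the description of the
topology of `X ∪ ∂X` by Gromov products (`FourPoint.tendsto_pt_iff`), and limits of geodesics along
an ultrafilter, which replace diagonal arguments (`exists_limit_ray`). A quasi-isometric embedding
distorts Gromov products at most linearly, so it admits a Cannon–Thurston map
(`IsQIEmbedding.admitsCTMap`).
-/

universe w

namespace CT

/-! ### Discrete geodesics and thin triangles -/

section Geodesics

variable {X : Type u} [MetricSpace X] {c : ℕ → X} {n : ℕ} {x y : X}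

theorem IsGeodesic.dist_left (h : IsGeodesic c n x y) {i : ℕ} (hi : i ≤ n) :
    dist x (c i) = i := by
  have := h.2.2 0 (Nat.zero_le n) i hi
  rw [h.1] at this
  simpa using this

theorem IsGeodesic.dist_right (h : IsGeodesic c n x y) {i : ℕ} (hi : i ≤ n) :
    dist (c i) y = n - i := by
  have := h.2.2 i hi n le_rfl
  have hi' : (i : ℝ) ≤ n := by exact_mod_cast hi
  rw [h.2.1, abs_sub_comm, abs_of_nonneg (by linarith)] at this
  exact this

theorem IsGeodesic.dist_eq (h : IsGeodesic c n x y) : dist x y = n := by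
  have := h.dist_left le_rfl
  rwa [h.2.1] at this

theorem IsGeodesic.symm (h : IsGeodesic c n x y) : IsGeodesic (fun i => c (n - i)) n y x := by
  refine ⟨by simpa using h.2.1, by simpa using h.1, fun i hi j hj => ?_⟩
  rw [h.2.2 _ (Nat.sub_le n i) _ (Nat.sub_le n j), Nat.cast_sub hi, Nat.cast_sub hj, abs_sub_comm]
  congr 1
  ring

theorem IsGeodesic.sub (h : IsGeodesic c n x y) {i j : ℕ} (hij : i ≤ j) (hj : j ≤ n) :
    IsGeodesic (fun t => c (i + t)) (j - i) (c i) (c j) := by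
  refine ⟨rfl, by simp only; congr 1; omega, fun s hs t ht => ?_⟩
  rw [h.2.2 _ (by omega) _ (by omega)]
  push_cast
  congr 1
  ring

/-- `δ ≥ 1` is a thinness constant for the geodesic triangles of `X`. The lower bound `1` serves
only to simplify estimates. -/
def ThinTriangles (X : Type u) [MetricSpace X] (δ : ℝ) : Prop :=
  1 ≤ δ ∧ ∀ (x y z : X) (a b c : ℕ → X) (l m n : ℕ),
    IsGeodesic a l x y → IsGeodesic b m x z → IsGeodesic c n z y →
      ∀ i ≤ l, (∃ j ≤ m, dist (a i) (b j) ≤ δ) ∨ (∃ j ≤ n, dist (a i) (c j) ≤ δ)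

theorem IsHyperbolic.exists_thinTriangles (h : IsHyperbolic X) : ∃ δ, ThinTriangles X δ := by
  obtain ⟨δ, hδ⟩ := h
  refine ⟨max δ 1, le_max_right _ _, fun x y z a b c l m n ha hb hc i hi => ?_⟩
  rcases hδ x y z a _ b l n m ha hc.symm hb i hi with ⟨j, hj, h⟩ | ⟨j, hj, h⟩
  · exact Or.inr ⟨n - j, Nat.sub_le _ _, h.trans (le_max_left _ _)⟩
  · exact Or.inl ⟨j, hj, h.trans (le_max_left _ _)⟩

/-- The metric spaces considered here: any two points are joined by a discrete geodesic, and all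
balls are finite. Vertex sets of locally finite connected graphs have these properties. -/
class ProperGeodesic (X : Type u) [MetricSpace X] : Prop where
  exists_geodesic : ∀ x y : X, ∃ (c : ℕ → X) (n : ℕ), IsGeodesic c n x y
  finite_closedBall : ∀ (x : X) (r : ℝ), (Metric.closedBall x r).Finite

/-- A discrete intermediate value principle: if each of `0, …, m` satisfies `A` or `B`, `0`
satisfies `A` and `m` satisfies `B`, then somewhere `A` passes over to `B`. -/
theorem exists_transition {A B : ℕ → Prop} {m : ℕ} (h0 : A 0) (hm : B m)
    (h : ∀ i ≤ m, A i ∨ B i) : ∃ i ≤ m, ∃ i' ≤ m, (i' = i ∨ i' = i + 1) ∧ A i ∧ B i' := by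
  classical
  have hex : ∃ i, B i := ⟨m, hm⟩
  have hle : Nat.find hex ≤ m := Nat.find_min' hex hm
  rcases Nat.eq_zero_or_pos (Nat.find hex) with h00 | hpos
  · exact ⟨0, Nat.zero_le _, 0, Nat.zero_le _, Or.inl rfl, h0, h00 ▸ Nat.find_spec hex⟩
  · refine ⟨Nat.find hex - 1, by omega, Nat.find hex, hle, Or.inr (by omega), ?_,
      Nat.find_spec hex⟩
    exact (h _ (by omega)).resolve_right (Nat.find_min hex (by omega))

theorem IsGeodesic.dist_transition (h : IsGeodesic c n x y) {i i' : ℕ} (hi : i ≤ n)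
    (hi' : i' ≤ n) (hii' : i' = i ∨ i' = i + 1) : dist (c i) (c i') ≤ 1 := by
  rw [h.2.2 i hi i' hi']
  rcases hii' with rfl | rfl <;> simp

end Geodesics

open ProperGeodesic

/-! ### Gromov products -/

section GromovProduct

variable {X : Type u} [MetricSpace X]

theorem gromovProduct_comm (o x y : X) : gromovProduct o x y = gromovProduct o y x := by
  unfold gromovProduct
  rw [dist_comm x y]
  ring

theorem gromovProduct_le_dist (o x y : X) : gromovProduct o x y ≤ dist y o := by
  unfold gromovProduct
  have := dist_triangle x y o
  linarith

theorem gromovProduct_sub_dist_le (o x y y' : X) :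
    gromovProduct o x y - dist y y' ≤ gromovProduct o x y' := by
  unfold gromovProduct
  have h1 := dist_triangle y y' o
  have h2 := dist_triangle x y y'
  linarith

theorem gromovProduct_sub_dist_basepoint_le (o o' x y : X) :
    gromovProduct o x y - dist o o' ≤ gromovProduct o' x y := by
  unfold gromovProduct
  have h1 := dist_triangle x o' o
  have h2 := dist_triangle y o' o
  rw [dist_comm o' o] at h1 h2
  linarith

theorem IsGeodesic.gromovProduct_le {c : ℕ → X} {n : ℕ} {x y : X} (h : IsGeodesic c n x y)
    {i : ℕ} (hi : i ≤ n) (o : X) : gromovProduct o x y ≤ dist (c i) o := by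
  unfold gromovProduct
  have h1 := dist_triangle x (c i) o
  have h2 := dist_triangle y (c i) o
  rw [dist_comm y (c i), h.dist_right hi] at h2
  rw [h.dist_left hi] at h1
  rw [h.dist_eq]
  linarith

/-- On a geodesic from `o` to `x`, the point at distance `i` has Gromov product `i` with `x`. -/
theorem IsGeodesic.gromovProduct_eq {c : ℕ → X} {n : ℕ} {o x : X} (h : IsGeodesic c n o x)
    {i : ℕ} (hi : i ≤ n) : gromovProduct o (c i) x = i := by
  unfold gromovProduct
  rw [dist_comm (c i) o, dist_comm x o, h.dist_left hi, h.dist_right hi, h.dist_eq]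
  ring

/-- Up to a constant, a geodesic `[x, y]` passes `o` within distance `(x | y)_o`. -/
theorem ThinTriangles.exists_dist_le_gromovProduct [ProperGeodesic X] {δ : ℝ}
    (hδ : ThinTriangles X δ) {c : ℕ → X} {n : ℕ} {x y : X} (h : IsGeodesic c n x y) (o : X) :
    ∃ i ≤ n, dist (c i) o ≤ gromovProduct o x y + (2 * δ + 1) := by
  obtain ⟨a, l, ha⟩ := exists_geodesic x o
  obtain ⟨b, m, hb⟩ := exists_geodesic o y
  have hδ1 := hδ.1
  obtain ⟨i, hi, i', hi', hii', ⟨j, hj, hA⟩, ⟨j', hj', hB⟩⟩ :=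
    exists_transition (A := fun i => ∃ j ≤ l, dist (c i) (a j) ≤ δ)
      (B := fun i => ∃ j ≤ m, dist (c i) (b j) ≤ δ) (m := n)
      ⟨0, Nat.zero_le _, by rw [h.1, ha.1, dist_self]; linarith⟩
      ⟨m, le_rfl, by rw [h.2.1, hb.2.1, dist_self]; linarith⟩
      (hδ.2 x y o c a b n l m h ha hb)
  refine ⟨i, hi, ?_⟩
  have hd := h.dist_transition hi hi' hii'
  have e1 := ha.dist_left hj
  have e2 := ha.dist_right hj
  have e3 := hb.dist_left hj'
  have e4 := hb.dist_right hj'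
  have e5 := h.dist_left hi
  have e6 := h.dist_right hi
  have t1 := dist_triangle (c i) (a j) o
  have t2 := dist_triangle x (a j) (c i)
  have t3 := dist_triangle (c i) (c i') o
  have t4 := dist_triangle (c i') (b j') o
  have t5 := dist_triangle4 (c i) (c i') (b j') y
  rw [dist_comm (a j) (c i)] at t2
  rw [dist_comm (b j') o] at t4
  unfold gromovProduct
  rw [h.dist_eq, ha.dist_eq, dist_comm y o, hb.dist_eq]
  linarith

/-- The Gromov products of `X` satisfy the four-point inequality with constant `D`. -/
def FourPoint (X : Type u) [MetricSpace X] (D : ℝ) : Prop :=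
  0 ≤ D ∧ ∀ (o x y z : X) (r : ℝ), r ≤ gromovProduct o x y → r ≤ gromovProduct o y z →
    r - D ≤ gromovProduct o x z

theorem IsHyperbolic.exists_fourPoint [ProperGeodesic X] (h : IsHyperbolic X) :
    ∃ D, FourPoint X D := by
  obtain ⟨δ, hδ⟩ := h.exists_thinTriangles
  have hδ1 := hδ.1
  refine ⟨3 * δ + 1, by linarith, fun o x y z r hxy hyz => ?_⟩
  obtain ⟨a, l, ha⟩ := exists_geodesic x z
  obtain ⟨b, m, hb⟩ := exists_geodesic x y
  obtain ⟨c, n, hc⟩ := exists_geodesic y z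
  obtain ⟨i, hi, hio⟩ := hδ.exists_dist_le_gromovProduct ha o
  rcases hδ.2 x z y a b c l m n ha hb hc i hi with ⟨j, hj, hd⟩ | ⟨j, hj, hd⟩
  · have h1 := hb.gromovProduct_le hj o
    have h2 := dist_triangle (b j) (a i) o
    rw [dist_comm (b j) (a i)] at h2
    linarith
  · have h1 := hc.gromovProduct_le hj o
    have h2 := dist_triangle (c j) (a i) o
    rw [dist_comm (c j) (a i)] at h2
    linarith

end GromovProduct

/-! ### Stability of quasigeodesics -/

section Morse

variable {X : Type u} [MetricSpace X] {k : ℝ} {p : ℕ → X} {n : ℕ}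

/-- `p 0, …, p n` is a quasigeodesic with constant `k`. -/
def IsQuasiGeodesic (k : ℝ) (p : ℕ → X) (n : ℕ) : Prop :=
  ∀ i ≤ n, ∀ j ≤ n, |(i : ℝ) - j| ≤ k * dist (p i) (p j) + k ∧
    dist (p i) (p j) ≤ k * |(i : ℝ) - j| + k

/-- In a space with thin triangles a geodesic is logarithmically close to any discrete path with
the same end points: bisect the path `k` times. -/
theorem ThinTriangles.dist_geodesic_path_le [ProperGeodesic X] {δ L : ℝ} (hδ : ThinTriangles X δ)
    (hL : 0 ≤ L) (hp : ∀ i < n, dist (p i) (p (i + 1)) ≤ L) (k : ℕ) :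
    ∀ (a b : ℕ), a ≤ b → b ≤ n → b - a ≤ 2 ^ k → ∀ (c : ℕ → X) (m : ℕ),
      IsGeodesic c m (p a) (p b) → ∀ i ≤ m, ∃ j ≤ n, dist (c i) (p j) ≤ δ * k + L := by
  have hδ1 := hδ.1
  induction k with
  | zero =>
    intro a b hab hb hk c m hc i hi
    refine ⟨a, hab.trans hb, ?_⟩
    have h1 : dist (c i) (p a) ≤ dist (p a) (p b) := by
      rw [dist_comm, hc.dist_left hi, hc.dist_eq]
      exact_mod_cast hi
    have h2 : dist (p a) (p b) ≤ L := by
      rcases Nat.eq_or_lt_of_le hab with rfl | hlt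
      · rwa [dist_self]
      · obtain rfl : b = a + 1 := by simp at hk; omega
        exact hp a (by omega)
    simpa using h1.trans h2
  | succ k ih =>
    intro a b hab hb hk c m hc i hi
    rw [pow_succ] at hk
    obtain ⟨e, r, he⟩ := exists_geodesic (p a) (p (a + (b - a) / 2))
    obtain ⟨f, s, hf⟩ := exists_geodesic (p (a + (b - a) / 2)) (p b)
    push_cast
    rcases hδ.2 _ _ _ c e f m r s hc he hf i hi with ⟨j, hj, hd⟩ | ⟨j, hj, hd⟩
    · obtain ⟨t, ht, htd⟩ := ih a (a + (b - a) / 2) (by omega) (by omega) (by omega) e r he j hj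
      refine ⟨t, ht, (dist_triangle (c i) (e j) (p t)).trans ?_⟩
      linarith
    · obtain ⟨t, ht, htd⟩ := ih (a + (b - a) / 2) b (by omega) (by omega) (by omega) f s hf j hj
      refine ⟨t, ht, (dist_triangle (c i) (f j) (p t)).trans ?_⟩
      linarith

theorem IsQuasiGeodesic.dist_geodesic_le [ProperGeodesic X] {δ : ℝ} (hδ : ThinTriangles X δ)
    (hk : 1 ≤ k) (hp : IsQuasiGeodesic k p n) (t : ℕ) {a b : ℕ} (ha : a ≤ n) (hb : b ≤ n)
    (hab : |(a : ℝ) - b| ≤ 2 ^ t) {c : ℕ → X} {m : ℕ} (hc : IsGeodesic c m (p a) (p b))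
    {i : ℕ} (hi : i ≤ m) : ∃ j ≤ n, dist (c i) (p j) ≤ δ * t + 2 * k := by
  have hstep : ∀ i < n, dist (p i) (p (i + 1)) ≤ 2 * k := fun i hi => by
    have := (hp i hi.le (i + 1) hi).2
    push_cast at this
    rw [show (i : ℝ) - (i + 1) = -1 by ring, abs_neg, abs_one] at this
    linarith
  have key := hδ.dist_geodesic_path_le (by linarith) hstep t
  rcases le_total a b with h | h
  · refine key a b h hb ?_ c m hc i hi
    rw [abs_sub_comm, ← Nat.cast_sub h, Nat.abs_cast] at hab
    exact_mod_cast hab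
  · rw [← Nat.cast_sub h, Nat.abs_cast] at hab
    obtain ⟨j, hj, hd⟩ := key b a h ha (by exact_mod_cast hab) _ m hc.symm (m - i) (Nat.sub_le _ _)
    refine ⟨j, hj, ?_⟩
    rwa [show m - (m - i) = i by omega] at hd

theorem exists_forall_linear_le_two_pow (A B : ℝ) :
    ∃ t₁ : ℕ, ∀ t : ℕ, t₁ ≤ t → A * t + B ≤ 2 ^ t := by
  have h1 : Tendsto (fun n : ℕ => (n : ℝ) ^ 1 / 2 ^ n) atTop (𝓝 0) :=
    tendsto_pow_const_div_const_pow_of_one_lt 1 one_lt_two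
  have h0 : Tendsto (fun n : ℕ => (n : ℝ) ^ 0 / 2 ^ n) atTop (𝓝 0) :=
    tendsto_pow_const_div_const_pow_of_one_lt 0 one_lt_two
  have h := (h1.const_mul A).add (h0.const_mul B)
  rw [mul_zero, mul_zero, add_zero] at h
  obtain ⟨t₁, ht₁⟩ := eventually_atTop.1 (h.eventually (gt_mem_nhds one_pos))
  refine ⟨t₁, fun t ht => ?_⟩
  have := ht₁ t ht
  have hpos : (0 : ℝ) < 2 ^ t := by positivity
  have e : A * ((t : ℝ) ^ 1 / 2 ^ t) + B * ((t : ℝ) ^ 0 / 2 ^ t) = (A * t + B) / 2 ^ t := by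
    ring
  rw [e, div_lt_one hpos] at this
  exact this.le

/-- The point where a geodesic deviates most from a quasigeodesic, at distance `D`, satisfies
`D ≤ 2δ + δt + 2k` as soon as `2 ^ t` exceeds a linear function of `D`. Go from this point about `2D`
along the geodesic in both directions, and from there to the quasigeodesic: the part of the
quasigeodesic in between has length linear in `D`, and so comes logarithmically close. -/
theorem IsQuasiGeodesic.deviation_le [ProperGeodesic X] {δ : ℝ} (hδ : ThinTriangles X δ)
    (hk : 1 ≤ k) (hp : IsQuasiGeodesic k p n) {c : ℕ → X} {m : ℕ}
    (hc : IsGeodesic c m (p 0) (p n)) {D : ℝ} {i₀ : ℕ} (hi₀ : i₀ ≤ m)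
    (hD : ∀ i ≤ m, ∃ j ≤ n, dist (c i) (p j) ≤ D) (hD₀ : ∀ j ≤ n, D ≤ dist (c i₀) (p j))
    (t : ℕ) (ht : k * (6 * D + 3) ≤ 2 ^ t) : D ≤ 2 * δ + (δ * t + 2 * k) := by
  have hδ1 := hδ.1
  have hD0 : 0 ≤ D := by
    obtain ⟨j, _, hj⟩ := hD 0 (Nat.zero_le _)
    exact dist_nonneg.trans hj
  set q := ⌈2 * D⌉₊ with hq
  have hq1 : 2 * D ≤ q := Nat.le_ceil _
  have hq2 : (q : ℝ) < 2 * D + 1 := Nat.ceil_lt_add_one (by linarith)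
  -- points `w` of a short geodesic at a far away, or terminal, point of `c` are far from `c i₀`
  have far : ∀ i ≤ m, (q : ℝ) ≤ dist (c i₀) (c i) → ∀ w, dist (c i) w ≤ D →
      D ≤ dist (c i₀) w := by
    intro i _ hi w hw
    have := dist_triangle (c i₀) w (c i)
    rw [dist_comm w] at this
    linarith
  obtain ⟨a, han, had, haw⟩ : ∃ a ≤ n, dist (c (i₀ - q)) (p a) ≤ D ∧
      ∀ w, dist (c (i₀ - q)) w ≤ dist (c (i₀ - q)) (p a) → D ≤ dist (c i₀) w := by
    rcases le_or_gt q i₀ with h | h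
    · obtain ⟨a, han, had⟩ := hD (i₀ - q) (by omega)
      refine ⟨a, han, had, fun w hw => far (i₀ - q) (by omega) ?_ w (hw.trans had)⟩
      rw [hc.2.2 _ hi₀ _ (by omega), Nat.cast_sub h]
      simp
    · have e : c (i₀ - q) = p 0 := by rw [Nat.sub_eq_zero_of_le h.le, hc.1]
      refine ⟨0, Nat.zero_le _, by rw [e, dist_self]; exact hD0, fun w hw => ?_⟩
      rw [e, dist_self] at hw
      rw [← dist_le_zero.1 hw]
      exact hD₀ 0 (Nat.zero_le _)
  obtain ⟨b, hbn, hbd, hbw⟩ : ∃ b ≤ n, dist (c (min (i₀ + q) m)) (p b) ≤ D ∧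
      ∀ w, dist (c (min (i₀ + q) m)) w ≤ dist (c (min (i₀ + q) m)) (p b) →
        D ≤ dist (c i₀) w := by
    rcases le_or_gt (i₀ + q) m with h | h
    · rw [min_eq_left h]
      obtain ⟨b, hbn, hbd⟩ := hD (i₀ + q) h
      refine ⟨b, hbn, hbd, fun w hw => far (i₀ + q) h ?_ w (hw.trans hbd)⟩
      rw [hc.2.2 _ hi₀ _ h, Nat.cast_add]
      simp
    · have e : c (min (i₀ + q) m) = p n := by rw [min_eq_right h.le, hc.2.1]
      refine ⟨n, le_rfl, by rw [e, dist_self]; exact hD0, fun w hw => ?_⟩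
      rw [e, dist_self] at hw
      rw [← dist_le_zero.1 hw]
      exact hD₀ n le_rfl
  have hlen : dist (c (i₀ - q)) (c (min (i₀ + q) m)) ≤ 2 * q := by
    have e1 : dist (c (i₀ - q)) (c i₀) ≤ q := by
      rw [hc.2.2 _ (by omega) _ hi₀, abs_sub_comm, ← Nat.cast_sub (Nat.sub_le _ _), Nat.abs_cast]
      exact_mod_cast (by omega)
    have e2 : dist (c i₀) (c (min (i₀ + q) m)) ≤ q := by
      rw [hc.2.2 _ hi₀ _ (by omega), abs_sub_comm, ← Nat.cast_sub (by omega), Nat.abs_cast]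
      exact_mod_cast (by omega)
    linarith [dist_triangle (c (i₀ - q)) (c i₀) (c (min (i₀ + q) m))]
  have hab : |(a : ℝ) - b| ≤ 2 ^ t := by
    refine le_trans ?_ ht
    refine (hp a han b hbn).1.trans ?_
    have h1 : dist (p a) (p b) ≤ 6 * D + 2 := by
      have := dist_triangle4 (p a) (c (i₀ - q)) (c (min (i₀ + q) m)) (p b)
      rw [dist_comm (p a) (c _)] at this
      linarith
    have : k * dist (p a) (p b) ≤ k * (6 * D + 2) := by gcongr
    linarith
  -- `c i₀` is close to one of the other three sides of a quadrangle
  obtain ⟨e, r, he⟩ := exists_geodesic (c (i₀ - q)) (p b)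
  obtain ⟨f, s, hf⟩ := exists_geodesic (p b) (c (min (i₀ + q) m))
  obtain ⟨g, u, hg⟩ := exists_geodesic (c (i₀ - q)) (p a)
  obtain ⟨l, v, hl⟩ := exists_geodesic (p a) (p b)
  have h0 : 0 ≤ δ * t + 2 * k := by positivity
  have hsub := hc.sub (i := i₀ - q) (j := min (i₀ + q) m) (by omega) (by omega)
  have hthin := hδ.2 _ _ _ _ e f _ r s hsub he hf (i₀ - (i₀ - q)) (by omega)
  simp only [show i₀ - q + (i₀ - (i₀ - q)) = i₀ by omega] at hthin
  rcases hthin with ⟨j, hj, hd⟩ | ⟨j, hj, hd⟩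
  · rcases hδ.2 _ _ _ _ g l _ u v he hg hl j hj with ⟨j', hj', hd'⟩ | ⟨j', hj', hd'⟩
    · have h1 := haw (g j') (by
        rw [hg.dist_left hj', hg.dist_eq]; exact_mod_cast hj')
      have := dist_triangle (c i₀) (e j) (g j')
      linarith
    · obtain ⟨w, hw, hwd⟩ := hp.dist_geodesic_le hδ hk t han hbn hab hl hj'
      have h1 := hD₀ w hw
      have := dist_triangle4 (c i₀) (e j) (l j') (p w)
      linarith
  · have h1 := hbw (f j) (by
      rw [dist_comm, hf.dist_right hj, dist_comm, hf.dist_eq]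
      have : (0 : ℝ) ≤ j := Nat.cast_nonneg j
      linarith)
    linarith

/-- A geodesic lies in a uniform neighbourhood of every quasigeodesic with the same end points. -/
theorem exists_geodesic_near_quasiGeodesic [ProperGeodesic X] (hX : IsHyperbolic X) {k : ℝ}
    (hk : 1 ≤ k) : ∃ R : ℝ, 0 ≤ R ∧ ∀ (p : ℕ → X) (n : ℕ), IsQuasiGeodesic k p n →
      ∀ (c : ℕ → X) (m : ℕ), IsGeodesic c m (p 0) (p n) →
        ∀ i ≤ m, ∃ j ≤ n, dist (c i) (p j) ≤ R := by
  obtain ⟨δ, hδ⟩ := hX.exists_thinTriangles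
  have hδ1 := hδ.1
  obtain ⟨t₁, ht₁⟩ := exists_forall_linear_le_two_pow (k * 6 * δ)
    (k * (6 * (2 * δ + (δ + 2 * k)) + 3))
  refine ⟨2 * δ + (δ * t₁ + 2 * k), by positivity, fun p n hp c m hc => ?_⟩
  let f : ℕ → ℝ := fun i =>
    (Finset.range (n + 1)).inf' Finset.nonempty_range_add_one (fun j => dist (c i) (p j))
  obtain ⟨i₀, hi₀, hmax⟩ := Finset.exists_max_image (Finset.range (m + 1)) f
    Finset.nonempty_range_add_one
  have hD : ∀ i ≤ m, ∃ j ≤ n, dist (c i) (p j) ≤ f i₀ := fun i hi => by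
    obtain ⟨j, hj, e⟩ := Finset.exists_mem_eq_inf' (Finset.nonempty_range_add_one (n := n))
      (fun j => dist (c i) (p j))
    refine ⟨j, Nat.lt_succ_iff.1 (Finset.mem_range.1 hj), ?_⟩
    rw [← e]
    exact hmax i (Finset.mem_range.2 (Nat.lt_succ_iff.2 hi))
  have hD₀ : ∀ j ≤ n, f i₀ ≤ dist (c i₀) (p j) := fun j hj =>
    Finset.inf'_le _ (Finset.mem_range.2 (Nat.lt_succ_iff.2 hj))
  have hi₀' : i₀ ≤ m := Nat.lt_succ_iff.1 (Finset.mem_range.1 hi₀)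
  -- the bound for `t + 1` implies the bound for `t`, as long as `t₁ ≤ t`
  have hdown : ∀ s : ℕ, f i₀ ≤ 2 * δ + (δ * (t₁ + s : ℕ) + 2 * k) →
      f i₀ ≤ 2 * δ + (δ * t₁ + 2 * k) := by
    intro s
    induction s with
    | zero => exact id
    | succ s ih =>
      intro h
      refine ih (hp.deviation_le hδ hk hc hi₀' hD hD₀ (t₁ + s) ?_)
      refine le_trans ?_ (ht₁ (t₁ + s) (Nat.le_add_right _ _))
      have : k * (6 * f i₀ + 3) ≤
          k * (6 * (2 * δ + (δ * (t₁ + (s + 1) : ℕ) + 2 * k)) + 3) := by gcongr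
      refine this.trans (le_of_eq ?_)
      push_cast
      ring
  have hfi : f i₀ ≤ 2 * δ + (δ * t₁ + 2 * k) := by
    obtain ⟨s, hs⟩ := exists_nat_ge (f i₀)
    refine hdown s (hs.trans ?_)
    push_cast
    have h1 : (0 : ℝ) ≤ s := Nat.cast_nonneg s
    have h2 : (0 : ℝ) ≤ δ * t₁ := by positivity
    nlinarith
  intro i hi
  obtain ⟨j, hj, h⟩ := hD i hi
  exact ⟨j, hj, h.trans hfi⟩

/-- A quasigeodesic lies in a uniform neighbourhood of every geodesic with the same end points:
somewhere the geodesic passes from the points close to the part before `p j` to those close to the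
part after `p j`. -/
theorem exists_quasiGeodesic_near_geodesic [ProperGeodesic X] (hX : IsHyperbolic X) {k : ℝ}
    (hk : 1 ≤ k) : ∃ R : ℝ, 0 ≤ R ∧ ∀ (p : ℕ → X) (n : ℕ), IsQuasiGeodesic k p n →
      ∀ (c : ℕ → X) (m : ℕ), IsGeodesic c m (p 0) (p n) →
        ∀ j ≤ n, ∃ i ≤ m, dist (c i) (p j) ≤ R := by
  obtain ⟨R, hR, h⟩ := exists_geodesic_near_quasiGeodesic hX hk
  refine ⟨R + (k * (k * (2 * R + 1) + k) + k), by positivity, fun p n hp c m hc j hj => ?_⟩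
  obtain ⟨i, hi, i', hi', hii', ⟨j₁, hj₁, hA⟩, ⟨j₂, hj₂, hj₂n, hB⟩⟩ :=
    exists_transition (A := fun i => ∃ j' ≤ j, dist (c i) (p j') ≤ R)
      (B := fun i => ∃ j', j ≤ j' ∧ j' ≤ n ∧ dist (c i) (p j') ≤ R) (m := m)
      ⟨0, Nat.zero_le _, by rwa [hc.1, dist_self]⟩
      ⟨n, hj, le_rfl, by rwa [hc.2.1, dist_self]⟩ (fun i hi => by
        obtain ⟨j', hj', hd⟩ := h p n hp c m hc i hi
        rcases le_total j' j with h' | h'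
        · exact Or.inl ⟨j', h', hd⟩
        · exact Or.inr ⟨j', h', hj', hd⟩)
  refine ⟨i, hi, ?_⟩
  have hd := hc.dist_transition hi hi' hii'
  have h1 : dist (p j₁) (p j₂) ≤ 2 * R + 1 := by
    have := dist_triangle4 (p j₁) (c i) (c i') (p j₂)
    rw [dist_comm (p j₁) (c i)] at this
    linarith
  have h2 : |(j₁ : ℝ) - j₂| ≤ k * (2 * R + 1) + k := by
    refine (hp j₁ (hj₁.trans hj) j₂ hj₂n).1.trans ?_
    gcongr
  have h3 : |(j₁ : ℝ) - j| ≤ |(j₁ : ℝ) - j₂| := by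
    have e1 : (j₁ : ℝ) ≤ j := by exact_mod_cast hj₁
    have e2 : (j : ℝ) ≤ j₂ := by exact_mod_cast hj₂
    rw [abs_sub_comm, abs_sub_comm (j₁ : ℝ), abs_of_nonneg (by linarith),
      abs_of_nonneg (by linarith)]
    linarith
  have h4 : dist (p j₁) (p j) ≤ k * (k * (2 * R + 1) + k) + k := by
    refine (hp j₁ (hj₁.trans hj) j hj).2.trans ?_
    have := h3.trans h2
    gcongr
  exact (dist_triangle (c i) (p j₁) (p j)).trans (add_le_add hA h4)

end Morse

/-! ### Quasi-isometric embeddings -/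

section QIEmbedding

variable {X : Type u} {Y : Type v} {Z : Type w} [MetricSpace X] [MetricSpace Y] [MetricSpace Z]

theorem isQIEmbedding_iff {f : X → Y} : IsQIEmbedding f ↔ ∃ k : ℝ, 1 ≤ k ∧ ∀ x x' : X,
    dist x x' ≤ k * dist (f x) (f x') + k ∧ dist (f x) (f x') ≤ k * dist x x' + k := by
  constructor
  · rintro ⟨k, hk, h⟩
    have hkk : k ≤ k * k := by nlinarith
    refine ⟨k * k, by nlinarith, fun x x' => ⟨?_, ?_⟩⟩
    · have h1 : k⁻¹ * dist x x' ≤ dist (f x) (f x') + k := by linarith [(h x x').1]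
      rw [inv_mul_le_iff₀ (by linarith)] at h1
      nlinarith [dist_nonneg (x := f x) (y := f x')]
    · nlinarith [(h x x').2, dist_nonneg (x := x) (y := x')]
  · rintro ⟨k, hk, h⟩
    refine ⟨k, hk, fun x x' => ⟨?_, (h x x').2⟩⟩
    have h1 : k⁻¹ * dist x x' ≤ dist (f x) (f x') + 1 := by
      rw [inv_mul_le_iff₀ (by linarith)]
      linarith [(h x x').1]
    linarith

theorem isQIEmbedding_of_bounds {f : X → Y} {a b c d : ℝ}
    (h : ∀ x x' : X, dist x x' ≤ a * dist (f x) (f x') + b)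
    (h' : ∀ x x' : X, dist (f x) (f x') ≤ c * dist x x' + d) : IsQIEmbedding f := by
  have ha := le_abs_self a
  have hb := le_abs_self b
  have hc := le_abs_self c
  have hd := le_abs_self d
  have ha' := abs_nonneg a
  have hb' := abs_nonneg b
  have hc' := abs_nonneg c
  have hd' := abs_nonneg d
  refine isQIEmbedding_iff.2 ⟨1 + |a| + |b| + |c| + |d|, by linarith, fun x x' => ⟨?_, ?_⟩⟩
  · nlinarith [h x x', dist_nonneg (x := f x) (y := f x')]
  · nlinarith [h' x x', dist_nonneg (x := x) (y := x')]

theorem IsQIEmbedding.comp {g : Y → Z} {f : X → Y} (hg : IsQIEmbedding g)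
    (hf : IsQIEmbedding f) : IsQIEmbedding (g ∘ f) := by
  obtain ⟨k, hk, hf⟩ := isQIEmbedding_iff.1 hf
  obtain ⟨l, hl, hg⟩ := isQIEmbedding_iff.1 hg
  refine isQIEmbedding_of_bounds (a := k * l) (b := k * l + k) (c := l * k) (d := l * k + l)
    (fun x x' => ?_) (fun x x' => ?_)
  · have h1 := (hf x x').1
    have h2 := (hg (f x) (f x')).1
    simp only [Function.comp]
    nlinarith
  · have h1 := (hf x x').2
    have h2 := (hg (f x) (f x')).2
    simp only [Function.comp]
    nlinarith

theorem IsQIEmbedding.comp_isometry {f : X → Y} (hf : IsQIEmbedding f) {e : Z → X}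
    (he : Isometry e) : IsQIEmbedding (f ∘ e) := by
  obtain ⟨k, hk, h⟩ := hf
  refine ⟨k, hk, fun z z' => ?_⟩
  rw [← he.dist_eq]
  exact h _ _

theorem IsQIEmbedding.tendsto_dist {a : ℕ → X} (ha : IsQIEmbedding a) :
    Tendsto (fun n => dist (a 0) (a n)) atTop atTop := by
  obtain ⟨k, hk, h⟩ := isQIEmbedding_iff.1 ha
  have h1 : Tendsto (fun n : ℕ => k⁻¹ * ((n : ℝ) - k)) atTop atTop :=
    (tendsto_atTop_add_const_right _ (-k) tendsto_natCast_atTop_atTop).const_mul_atTop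
      (by positivity)
  refine tendsto_atTop_mono (fun n => ?_) h1
  rw [inv_mul_le_iff₀ (by linarith)]
  have := (h 0 n).1
  rw [Nat.dist_eq] at this
  simp only [Nat.cast_zero, zero_sub, abs_neg, Nat.abs_cast] at this
  linarith

end QIEmbedding

/-! ### Geodesic rays and Gromov products -/

section Rays

variable {X : Type u} [MetricSpace X]

/-- The boundary point represented by a geodesic ray. -/
def GeodesicRay.endpoint (c : GeodesicRay X) : Boundary X := Quotient.mk (rayEquiv X) c

theorem Boundary.exists_rep (ξ : Boundary X) : ∃ c : GeodesicRay X, c.endpoint = ξ :=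
  Quotient.exists_rep ξ

theorem hausdorffEDist_range_ne_top_iff {a b : ℕ → X} :
    Metric.hausdorffEDist (range a) (range b) ≠ ⊤ ↔
      ∃ R : ℝ, (∀ i, ∃ j, dist (a i) (b j) ≤ R) ∧ ∀ j, ∃ i, dist (b j) (a i) ≤ R := by
  constructor
  · intro h
    obtain ⟨R, hR⟩ := ENNReal.lt_iff_exists_nnreal_btwn.1 (lt_top_iff_ne_top.2 h)
    refine ⟨R, fun i => ?_, fun j => ?_⟩
    · obtain ⟨_, ⟨j, rfl⟩, hj⟩ :=
        Metric.exists_edist_lt_of_hausdorffEDist_lt (mem_range_self i) hR.1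
      rw [edist_lt_coe] at hj
      exact ⟨j, hj.le⟩
    · have hR' := hR.1
      rw [Metric.hausdorffEDist_comm] at hR'
      obtain ⟨_, ⟨i, rfl⟩, hi⟩ :=
        Metric.exists_edist_lt_of_hausdorffEDist_lt (mem_range_self j) hR'
      rw [edist_lt_coe] at hi
      exact ⟨i, hi.le⟩
  · rintro ⟨R, h1, h2⟩
    refine ne_top_of_le_ne_top (ENNReal.ofReal_ne_top (r := R))
      (Metric.hausdorffEDist_le_of_mem_edist ?_ ?_)
    · rintro _ ⟨i, rfl⟩
      obtain ⟨j, hj⟩ := h1 i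
      exact ⟨_, mem_range_self j, by rw [edist_dist]; exact ENNReal.ofReal_le_ofReal hj⟩
    · rintro _ ⟨j, rfl⟩
      obtain ⟨i, hi⟩ := h2 j
      exact ⟨_, mem_range_self i, by rw [edist_dist]; exact ENNReal.ofReal_le_ofReal hi⟩

theorem GeodesicRay.dist_eq (c : GeodesicRay X) (i j : ℕ) :
    dist (c.1 i) (c.1 j) = |(i : ℝ) - j| := by
  rw [c.2.dist_eq, Nat.dist_eq]

theorem GeodesicRay.le_gromovProduct (c : GeodesicRay X) {t : ℝ} {i j : ℕ} (hi : t ≤ i)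
    (hj : t ≤ j) : t ≤ gromovProduct (c.1 0) (c.1 i) (c.1 j) := by
  unfold gromovProduct
  rw [c.dist_eq, c.dist_eq, c.dist_eq]
  simp only [Nat.cast_zero, sub_zero, Nat.abs_cast]
  have : |(i : ℝ) - j| ≤ i + j - 2 * t := abs_le.2 ⟨by linarith, by linarith⟩
  linarith

/-- A sequence that stays close to a geodesic ray and leaves every ball converges to the end of
the ray in the sense of Gromov products. -/
theorem GeodesicRay.exists_forall_le_gromovProduct (c : GeodesicRay X) {a : ℕ → X} {R : ℝ}
    (hR : ∀ j, ∃ m, dist (a j) (c.1 m) ≤ R)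
    (ha : Tendsto (fun n => dist (a 0) (a n)) atTop atTop) (o : X) (r : ℝ) :
    ∃ N : ℕ, ∀ i ≥ N, ∀ j ≥ N, r ≤ gromovProduct o (c.1 i) (a j) := by
  set t := r + R + dist (c.1 0) o with ht
  obtain ⟨N₁, hN₁⟩ := exists_nat_ge t
  obtain ⟨N₂, hN₂⟩ := eventually_atTop.1
    (ha.eventually_ge_atTop (t + R + dist (c.1 0) (a 0)))
  refine ⟨max N₁ N₂, fun i hi j hj => ?_⟩
  obtain ⟨m, hm⟩ := hR j
  have h1 : t ≤ i := hN₁.trans (by exact_mod_cast (le_max_left _ _).trans hi)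
  have h2 := hN₂ j ((le_max_right _ _).trans hj)
  have h3 : t ≤ m := by
    have e : dist (c.1 0) (c.1 m) = m := by rw [c.dist_eq]; simp
    have := dist_triangle4 (a 0) (c.1 0) (c.1 m) (a j)
    rw [e, dist_comm (c.1 m), dist_comm (a 0) (c.1 0)] at this
    linarith
  have h4 := c.le_gromovProduct h1 h3
  have h5 := gromovProduct_sub_dist_basepoint_le (c.1 0) o (c.1 i) (c.1 m)
  have h6 := gromovProduct_sub_dist_le o (c.1 i) (c.1 m) (a j)
  rw [dist_comm (c.1 m)] at h6
  linarith

theorem GeodesicRay.tendsto_dist (c : GeodesicRay X) :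
    Tendsto (fun n => dist (c.1 0) (c.1 n)) atTop atTop := by
  simp only [c.dist_eq, Nat.cast_zero, zero_sub, abs_neg, Nat.abs_cast]
  exact tendsto_natCast_atTop_atTop

theorem GeodesicRay.gromovProduct_of_endpoint_eq {c c' : GeodesicRay X}
    (h : c.endpoint = c'.endpoint) (o : X) (r : ℝ) :
    ∃ N : ℕ, ∀ i ≥ N, ∀ j ≥ N, r ≤ gromovProduct o (c.1 i) (c'.1 j) := by
  obtain ⟨R, -, hR⟩ := hausdorffEDist_range_ne_top_iff.1 (Quotient.exact h :)
  exact c.exists_forall_le_gromovProduct hR c'.tendsto_dist o r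

theorem GeodesicRay.endpoint_eq_of_gromovProduct {D : ℝ} (hD : FourPoint X D)
    {c c' : GeodesicRay X} {o : X}
    (h : ∀ r : ℝ, ∃ N : ℕ, ∀ i ≥ N, ∀ j ≥ N, r ≤ gromovProduct o (c.1 i) (c'.1 j)) :
    c.endpoint = c'.endpoint := by
  have hD0 := hD.1
  have key : ∀ t : ℕ, dist (c.1 t) (c'.1 t) ≤ 4 * D + 5 * dist (c'.1 0) (c.1 0) := by
    intro t
    obtain ⟨N, hN⟩ := h (t + dist o (c.1 0))
    have h1 := hN (max N t) (le_max_left _ _) (max N t) (le_max_left _ _)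
    have h2 := gromovProduct_sub_dist_basepoint_le o (c.1 0) (c.1 (max N t)) (c'.1 (max N t))
    have hm : (t : ℝ) ≤ (max N t : ℕ) := by exact_mod_cast le_max_right N t
    have h3 := c.le_gromovProduct (i := t) le_rfl hm
    have h4 := c'.le_gromovProduct (j := t) hm le_rfl
    have h5 := gromovProduct_sub_dist_basepoint_le (c'.1 0) (c.1 0) (c'.1 (max N t)) (c'.1 t)
    have hd := dist_nonneg (x := c'.1 0) (y := c.1 0)
    have h6 := hD.2 (c.1 0) (c.1 t) (c.1 (max N t)) (c'.1 (max N t)) t h3 (by linarith)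
    have h7 := hD.2 (c.1 0) (c.1 t) (c'.1 (max N t)) (c'.1 t) (t - D - dist (c'.1 0) (c.1 0))
      (by linarith) (by linarith)
    unfold gromovProduct at h7
    have e1 : dist (c.1 t) (c.1 0) = t := by rw [c.dist_eq]; simp
    have e2 : dist (c'.1 t) (c'.1 0) = t := by rw [c'.dist_eq]; simp
    have := dist_triangle (c'.1 t) (c'.1 0) (c.1 0)
    linarith
  refine Quotient.sound (hausdorffEDist_range_ne_top_iff.2 ⟨_, fun t => ⟨t, key t⟩, fun t => ⟨t, ?_⟩⟩)
  rw [dist_comm]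
  exact key t

end Rays

/-! ### The topology of `X ∪ ∂X` -/

section Compactification

variable {X : Type u} [MetricSpace X] {D : ℝ}

open Compactification

theorem pt_mem_basicNhd_of_eventually {c : GeodesicRay X} {o x : X} {r : ℝ}
    (h : ∀ᶠ i in atTop, r ≤ gromovProduct o (c.1 i) x) : pt x ∈ basicNhd o r c.endpoint :=
  ⟨c, rfl, eventually_atTop.1 h⟩

theorem FourPoint.eventually_of_pt_mem (hD : FourPoint X D) {c : GeodesicRay X} {o x : X} {r : ℝ}
    (h : pt x ∈ basicNhd o r c.endpoint) : ∀ᶠ i in atTop, r - D ≤ gromovProduct o (c.1 i) x := by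
  obtain ⟨c', hc', N', hN'⟩ := h
  obtain ⟨N, hN⟩ := GeodesicRay.gromovProduct_of_endpoint_eq (c := c) (c' := c') hc'.symm o r
  filter_upwards [eventually_ge_atTop N] with i hi
  exact hD.2 o _ _ _ r (hN i hi (max N N') (le_max_left _ _)) (hN' _ (le_max_right _ _))

theorem bdry_mem_basicNhd_of_forall {c c' : GeodesicRay X} {o : X} {r : ℝ} {N : ℕ}
    (h : ∀ i ≥ N, ∀ j ≥ N, r ≤ gromovProduct o (c.1 i) (c'.1 j)) :
    bdry c'.endpoint ∈ basicNhd o r c.endpoint :=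
  ⟨c, c', rfl, rfl, N, h⟩

theorem FourPoint.forall_of_bdry_mem (hD : FourPoint X D) {c c' : GeodesicRay X} {o : X} {r : ℝ}
    (h : bdry c'.endpoint ∈ basicNhd o r c.endpoint) :
    ∃ N : ℕ, ∀ i ≥ N, ∀ j ≥ N, r - 2 * D ≤ gromovProduct o (c.1 i) (c'.1 j) := by
  have hD0 := hD.1
  obtain ⟨d, d', hd, hd', N, hN⟩ := h
  obtain ⟨N₁, hN₁⟩ := GeodesicRay.gromovProduct_of_endpoint_eq (c := c) (c' := d) hd.symm o r
  obtain ⟨N₂, hN₂⟩ := GeodesicRay.gromovProduct_of_endpoint_eq (c := d') (c' := c') hd' o r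
  refine ⟨max N (max N₁ N₂), fun i hi j hj => ?_⟩
  have hm : max N (max N₁ N₂) ≥ N ∧ max N (max N₁ N₂) ≥ N₁ ∧ max N (max N₁ N₂) ≥ N₂ := by
    refine ⟨?_, ?_, ?_⟩ <;> simp
  have h1 := hD.2 o _ _ _ r (hN₁ i (hm.2.1.trans hi) _ hm.2.1) (hN _ hm.1 _ hm.1)
  have h2 := hD.2 o _ _ _ (r - D) h1 ((by linarith : r - D ≤ r).trans
    (hN₂ _ hm.2.2 j (hm.2.2.trans hj)))
  linarith

theorem FourPoint.basicNhd_subset (hD : FourPoint X D) {ξ η : Boundary X} {o : X} {r : ℝ}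
    (h : bdry η ∈ basicNhd o r ξ) : basicNhd o r η ⊆ basicNhd o (r - 3 * D) ξ := by
  have hD0 := hD.1
  obtain ⟨c, rfl⟩ := ξ.exists_rep
  obtain ⟨c', rfl⟩ := η.exists_rep
  obtain ⟨N, hN⟩ := hD.forall_of_bdry_mem h
  rintro (x | ζ) hp
  · obtain ⟨N', hN'⟩ := eventually_atTop.1 (hD.eventually_of_pt_mem hp)
    refine pt_mem_basicNhd_of_eventually ?_
    filter_upwards [eventually_ge_atTop N] with i hi
    have := hD.2 o _ _ _ (r - 2 * D) (hN i hi (max N N') (le_max_left _ _))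
      ((by linarith : r - 2 * D ≤ r - D).trans (hN' _ (le_max_right _ _)))
    linarith
  · obtain ⟨e, rfl⟩ := ζ.exists_rep
    obtain ⟨N', hN'⟩ := hD.forall_of_bdry_mem hp
    refine bdry_mem_basicNhd_of_forall (N := max N N') fun i hi j hj => ?_
    have := hD.2 o _ _ _ (r - 2 * D) (hN i ((le_max_left _ _).trans hi) (max N N')
      (le_max_left _ _)) (hN' _ (le_max_right _ _) j ((le_max_right _ _).trans hj))
    linarith

theorem basicNhd_basepoint_subset (o o' : X) (r : ℝ) (ξ : Boundary X) :
    basicNhd o (r + dist o o') ξ ⊆ basicNhd o' r ξ := by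
  rintro (x | η) hp
  · obtain ⟨c, hc, N, hN⟩ := hp
    exact ⟨c, hc, N, fun i hi => by
      linarith [hN i hi, gromovProduct_sub_dist_basepoint_le o o' (c.1 i) x]⟩
  · obtain ⟨c, c', hc, hc', N, hN⟩ := hp
    exact ⟨c, c', hc, hc', N, fun i hi j hj => by
      linarith [hN i hi j hj, gromovProduct_sub_dist_basepoint_le o o' (c.1 i) (c'.1 j)]⟩

theorem bdry_mem_basicNhd_self (o : X) (r : ℝ) (ξ : Boundary X) : bdry ξ ∈ basicNhd o r ξ := by
  obtain ⟨c, rfl⟩ := ξ.exists_rep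
  obtain ⟨N, hN⟩ := GeodesicRay.gromovProduct_of_endpoint_eq (c := c) rfl o r
  exact bdry_mem_basicNhd_of_forall hN

theorem FourPoint.basicNhd_mem_nhds (hD : FourPoint X D) (o : X) (r : ℝ) (ξ : Boundary X) :
    basicNhd o r ξ ∈ 𝓝 (bdry ξ) := by
  -- the interior of `basicNhd o r ξ`, described explicitly
  let U : Set (Compactification X) :=
    {p | p ∈ basicNhd o r ξ ∧ ∀ η, p = bdry η → ∃ s, basicNhd o s η ⊆ basicNhd o r ξ}
  refine mem_nhds_iff.2 ⟨U, fun p hp => hp.1, ?_, bdry_mem_basicNhd_self o r ξ, ?_⟩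
  · intro o' η hη
    obtain ⟨s, hs⟩ := hη.2 η rfl
    have h3 : basicNhd o (s + 3 * D) η ⊆ basicNhd o r ξ :=
      (basicNhd_anti o η (by linarith [hD.1])).trans hs
    refine ⟨s + 3 * D + dist o' o, fun p hp => ?_⟩
    have hp' := basicNhd_basepoint_subset o' o _ η hp
    refine ⟨h3 hp', fun ζ hζ => ⟨s + 3 * D, ?_⟩⟩
    subst hζ
    refine (hD.basicNhd_subset hp').trans ?_
    rwa [add_sub_cancel_right]
  · intro η hη
    cases hη
    exact ⟨r, Subset.rfl⟩

theorem FourPoint.nhds_hasBasis (hD : FourPoint X D) (o : X) (ξ : Boundary X) :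
    (𝓝 (bdry ξ)).HasBasis (fun _ : ℝ => True) (fun r => basicNhd o r ξ) := by
  refine ⟨fun U => ⟨fun hU => ?_, fun ⟨r, _, hr⟩ => mem_of_superset (hD.basicNhd_mem_nhds o r ξ) hr⟩⟩
  obtain ⟨V, hVU, hV, hξ⟩ := mem_nhds_iff.1 hU
  obtain ⟨r, hr⟩ := hV o ξ hξ
  exact ⟨r, trivial, hr.trans hVU⟩

/-- Convergence to the end of a geodesic ray, in terms of Gromov products. -/
theorem FourPoint.tendsto_pt_iff (hD : FourPoint X D) {ι : Type*} {l : Filter ι} {x : ι → X}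
    {c : GeodesicRay X} (o : X) : Tendsto (fun n => pt (x n)) l (𝓝 (bdry c.endpoint)) ↔
      ∀ r : ℝ, ∀ᶠ n in l, ∀ᶠ i in atTop, r ≤ gromovProduct o (c.1 i) (x n) := by
  rw [(hD.nhds_hasBasis o _).tendsto_right_iff]
  constructor
  · intro h r
    filter_upwards [h (r + D) trivial] with n hn
    simpa using hD.eventually_of_pt_mem hn
  · intro h r _
    filter_upwards [h r] with n hn
    exact pt_mem_basicNhd_of_eventually hn

theorem FourPoint.tendsto_unique (hD : FourPoint X D) {ι : Type*} {l : Filter ι} [l.NeBot]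
    {x : ι → X} {ξ η : Boundary X} (hξ : Tendsto (fun n => pt (x n)) l (𝓝 (bdry ξ)))
    (hη : Tendsto (fun n => pt (x n)) l (𝓝 (bdry η))) : ξ = η := by
  obtain ⟨c, rfl⟩ := ξ.exists_rep
  obtain ⟨c', rfl⟩ := η.exists_rep
  refine GeodesicRay.endpoint_eq_of_gromovProduct hD (o := c.1 0) fun r => ?_
  obtain ⟨n, hn, hn'⟩ := (((hD.tendsto_pt_iff (c.1 0)).1 hξ (r + D)).and
    ((hD.tendsto_pt_iff (c.1 0)).1 hη (r + D))).exists
  obtain ⟨N, hN⟩ := eventually_atTop.1 (hn.and hn')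
  refine ⟨N, fun i hi j hj => ?_⟩
  have h2 := (hN j hj).2
  rw [gromovProduct_comm] at h2
  have := hD.2 _ _ _ _ _ (hN i hi).1 h2
  linarith

theorem FourPoint.tendsto_of_dist_le (hD : FourPoint X D) {ι : Type*} {l : Filter ι}
    {x y : ι → X} {ξ : Boundary X} (hξ : Tendsto (fun n => pt (x n)) l (𝓝 (bdry ξ))) {R : ℝ}
    (h : ∀ n, dist (x n) (y n) ≤ R) : Tendsto (fun n => pt (y n)) l (𝓝 (bdry ξ)) := by
  obtain ⟨c, rfl⟩ := ξ.exists_rep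
  refine (hD.tendsto_pt_iff (c.1 0)).2 fun r => ?_
  filter_upwards [(hD.tendsto_pt_iff (c.1 0)).1 hξ (r + R)] with n hn
  filter_upwards [hn] with i hi
  linarith [gromovProduct_sub_dist_le (c.1 0) (c.1 i) (x n) (y n), h n]

/-- Two sequences with the same limit have Gromov products tending to infinity. -/
theorem FourPoint.eventually_le_gromovProduct (hD : FourPoint X D) {ι : Type*} {l : Filter ι}
    {x y : ι → X} {ξ : Boundary X} (hx : Tendsto (fun n => pt (x n)) l (𝓝 (bdry ξ)))
    (hy : Tendsto (fun n => pt (y n)) l (𝓝 (bdry ξ))) (o : X) (r : ℝ) :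
    ∀ᶠ n in l, r ≤ gromovProduct o (x n) (y n) := by
  obtain ⟨c, rfl⟩ := ξ.exists_rep
  filter_upwards [(hD.tendsto_pt_iff o).1 hx (r + D), (hD.tendsto_pt_iff o).1 hy (r + D)]
    with n hn hn'
  obtain ⟨i, hi, hi'⟩ := (hn.and hn').exists
  rw [gromovProduct_comm] at hi
  linarith [hD.2 _ _ _ _ _ hi hi']

theorem FourPoint.tendsto_dist (hD : FourPoint X D) {ι : Type*} {l : Filter ι} {x : ι → X}
    {ξ : Boundary X} (hx : Tendsto (fun n => pt (x n)) l (𝓝 (bdry ξ))) (o : X) :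
    Tendsto (fun n => dist o (x n)) l atTop := by
  refine tendsto_atTop.2 fun r => ?_
  filter_upwards [hD.eventually_le_gromovProduct hx hx o r] with n hn
  rw [dist_comm]
  exact hn.trans (gromovProduct_le_dist _ _ _)

theorem FourPoint.tendsto_of_near_ray (hD : FourPoint X D) {a : ℕ → X} {ξ : Boundary X}
    (h : EndsAt a ξ) (ha : Tendsto (fun n => dist (a 0) (a n)) atTop atTop) :
    Tendsto (fun n => pt (a n)) atTop (𝓝 (bdry ξ)) := by
  obtain ⟨c, rfl, hc⟩ := h
  obtain ⟨R, hR, -⟩ := hausdorffEDist_range_ne_top_iff.1 hc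
  refine (hD.tendsto_pt_iff (c := c) (a 0)).2 fun r => ?_
  obtain ⟨N, hN⟩ := c.exists_forall_le_gromovProduct hR ha (a 0) r
  filter_upwards [eventually_ge_atTop N] with j hj
  filter_upwards [eventually_ge_atTop N] with i hi
  exact hN i hi j hj

theorem FourPoint.tendsto_ray (hD : FourPoint X D) (c : GeodesicRay X) :
    Tendsto (fun n => pt (c.1 n)) atTop (𝓝 (bdry c.endpoint)) :=
  hD.tendsto_of_near_ray ⟨c, rfl, by rw [Metric.hausdorffEDist_self]; exact ENNReal.zero_ne_top⟩
    c.tendsto_dist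

theorem FourPoint.mem_limitSet_iff (hD : FourPoint X D) {A : Set X} {ξ : Boundary X} :
    ξ ∈ limitSet A ↔
      ∃ a : ℕ → X, (∀ n, a n ∈ A) ∧ Tendsto (fun n => pt (a n)) atTop (𝓝 (bdry ξ)) := by
  obtain ⟨c, rfl⟩ := ξ.exists_rep
  constructor
  · intro h
    have h' := accPt_iff_nhds.1 h
    have : ∀ n : ℕ, ∃ a ∈ A, pt a ∈ basicNhd (c.1 0) n c.endpoint := fun n => by
      obtain ⟨_, ⟨hU, a, ha, rfl⟩, -⟩ := h' _ (hD.basicNhd_mem_nhds (c.1 0) n c.endpoint)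
      exact ⟨a, ha, hU⟩
    choose a ha hU using this
    refine ⟨a, ha, (hD.nhds_hasBasis (c.1 0) _).tendsto_right_iff.2 fun r _ => ?_⟩
    obtain ⟨N, hN⟩ := exists_nat_ge r
    filter_upwards [eventually_ge_atTop N] with n hn
    exact basicNhd_anti _ _ (hN.trans (by exact_mod_cast hn)) (hU n)
  · rintro ⟨a, ha, h⟩
    refine accPt_iff_nhds.2 fun U hU => ?_
    obtain ⟨n, hn⟩ := (h.eventually hU).exists
    exact ⟨pt (a n), ⟨hn, a n, ha n, rfl⟩, by simp⟩

end Compactification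

/-! ### Limits of geodesics and sequential compactness -/

section Compactness

variable {X : Type u} [MetricSpace X]

open Compactification

theorem exists_ultralimit {ι α : Type*} (𝒰 : Ultrafilter ℕ) (f : ℕ → ι → α)
    (h : ∀ i, ∃ s : Set α, s.Finite ∧ ∀ᶠ n in 𝒰, f n i ∈ s) :
    ∃ g : ι → α, ∀ i, ∀ᶠ n in 𝒰, f n i = g i := by
  have : ∀ i, ∃ a, ∀ᶠ n in 𝒰, f n i = a := fun i => by
    obtain ⟨s, hs, hi⟩ := h i
    have h2 : (⋃ a ∈ s, {n | f n i = a}) ∈ 𝒰 := by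
      filter_upwards [hi] with n hn
      simpa using hn
    obtain ⟨a, -, ha⟩ := (Ultrafilter.finite_biUnion_mem_iff hs).1 h2
    exact ⟨a, ha⟩
  choose g hg using this
  exact ⟨g, hg⟩

/-- Geodesics from `o` of unbounded length accumulate at a geodesic ray, here obtained as their
limit along an ultrafilter. -/
theorem exists_limit_ray [ProperGeodesic X] {o : X} {x : ℕ → X} {g : ℕ → ℕ → X} {len : ℕ → ℕ}
    (hg : ∀ n, IsGeodesic (g n) (len n) o (x n))
    (hx : Tendsto (fun n => dist o (x n)) atTop atTop) :
    ∃ c : GeodesicRay X, ∀ t : ℕ, ∀ᶠ n in hyperfilter ℕ, t ≤ len n ∧ ∀ s ≤ t, g n s = c.1 s := by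
  have hlen : ∀ t : ℕ, ∀ᶠ n in hyperfilter ℕ, t ≤ len n := fun t => by
    filter_upwards [(hx.eventually_ge_atTop (t : ℝ)).filter_mono Nat.hyperfilter_le_atTop]
      with n hn
    rw [(hg n).dist_eq] at hn
    exact_mod_cast hn
  obtain ⟨c, hc⟩ := exists_ultralimit (hyperfilter ℕ) g fun i =>
    ⟨Metric.closedBall o i, finite_closedBall o i, by
      filter_upwards [hlen i] with n hn
      rw [Metric.mem_closedBall, dist_comm, (hg n).dist_left hn]⟩
  refine ⟨⟨c, Isometry.of_dist_eq fun i j => ?_⟩, fun t => ?_⟩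
  · obtain ⟨n, hi, hj, hin, hjn⟩ :=
      ((hc i).and ((hc j).and ((hlen i).and (hlen j)))).exists
    rw [← hi, ← hj, (hg n).2.2 i hin j hjn, Nat.dist_eq]
  · exact (hlen t).and ((finite_le_nat t).eventually_all.2 fun s _ => hc s)

theorem FourPoint.tendsto_hyperfilter {D : ℝ} (hD : FourPoint X D) {o : X} {x : ℕ → X}
    {g : ℕ → ℕ → X} {len : ℕ → ℕ} (hg : ∀ n, IsGeodesic (g n) (len n) o (x n))
    {c : GeodesicRay X}
    (hc : ∀ t : ℕ, ∀ᶠ n in hyperfilter ℕ, t ≤ len n ∧ ∀ s ≤ t, g n s = c.1 s) :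
    Tendsto (fun n => pt (x n)) (hyperfilter ℕ) (𝓝 (bdry c.endpoint)) := by
  have h0 : c.1 0 = o := by
    obtain ⟨n, -, hn⟩ := (hc 0).exists
    rw [← hn 0 le_rfl, (hg n).1]
  refine (hD.tendsto_pt_iff o).2 fun r => ?_
  obtain ⟨t, ht⟩ := exists_nat_ge (r + D)
  filter_upwards [hc t] with n hn
  filter_upwards [eventually_ge_atTop t] with i hi
  have h1 := (hg n).gromovProduct_eq hn.1
  rw [hn.2 t le_rfl] at h1
  have h2 := c.le_gromovProduct (t := t) (i := i) (j := t) (by exact_mod_cast hi) le_rfl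
  rw [h0] at h2
  linarith [hD.2 o _ _ _ t h2 h1.ge]

theorem FourPoint.exists_tendsto_subseq [ProperGeodesic X] {D : ℝ} (hD : FourPoint X D) {o : X}
    {x : ℕ → X} (hx : Tendsto (fun n => dist o (x n)) atTop atTop) :
    ∃ (ξ : Boundary X) (φ : ℕ → ℕ), Tendsto φ atTop atTop ∧
      Tendsto (fun n => pt (x (φ n))) atTop (𝓝 (bdry ξ)) := by
  choose g len hg using fun n => exists_geodesic o (x n)
  obtain ⟨c, hc⟩ := exists_limit_ray hg hx
  have ht := hD.tendsto_hyperfilter hg hc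
  have : ∀ m : ℕ, ∃ n ≥ m, pt (x n) ∈ basicNhd o m c.endpoint := fun m => by
    obtain ⟨n, hn, hn'⟩ := (((eventually_ge_atTop m).filter_mono Nat.hyperfilter_le_atTop).and
      (ht.eventually (hD.basicNhd_mem_nhds o m c.endpoint))).exists
    exact ⟨n, hn, hn'⟩
  choose φ hφ hφ' using this
  refine ⟨c.endpoint, φ, tendsto_atTop_mono hφ tendsto_id,
    (hD.nhds_hasBasis o _).tendsto_right_iff.2 fun r _ => ?_⟩
  obtain ⟨N, hN⟩ := exists_nat_ge r
  filter_upwards [eventually_ge_atTop N] with n hn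
  exact basicNhd_anti _ _ (hN.trans (by exact_mod_cast hn)) (hφ' n)

end Compactness

/-! ### Quasigeodesic rays and lines -/

section Quasigeodesics

variable {X : Type u} [MetricSpace X] [ProperGeodesic X]

open Compactification

theorem IsQIEmbedding.exists_endsAt (hX : IsHyperbolic X) {b : ℕ → X} (hb : IsQIEmbedding b) :
    ∃ ξ, EndsAt b ξ := by
  obtain ⟨k, hk, hq⟩ := isQIEmbedding_iff.1 hb
  have hqn : ∀ n, IsQuasiGeodesic k b n := fun n i _ j _ => by
    have := hq i j
    rwa [Nat.dist_eq] at this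
  obtain ⟨R, hR, h1⟩ := exists_geodesic_near_quasiGeodesic hX hk
  obtain ⟨R', hR', h2⟩ := exists_quasiGeodesic_near_geodesic hX hk
  choose g len hg using fun n => exists_geodesic (b 0) (b n)
  obtain ⟨c, hc⟩ := exists_limit_ray hg hb.tendsto_dist
  refine ⟨c.endpoint, c, rfl, hausdorffEDist_range_ne_top_iff.2 ⟨max R R', fun m => ?_, fun t => ?_⟩⟩
  · obtain ⟨T, hT⟩ := exists_nat_ge (R' + dist (b 0) (b m))
    obtain ⟨n, hn, hm⟩ := ((hc T).and
      ((eventually_ge_atTop m).filter_mono Nat.hyperfilter_le_atTop)).exists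
    obtain ⟨i, hi, hd⟩ := h2 b n (hqn n) (g n) (len n) (hg n) m hm
    have hiT : i ≤ T := by
      have e := (hg n).dist_left hi
      have := dist_triangle (b 0) (b m) (g n i)
      rw [dist_comm (b m)] at this
      have : (i : ℝ) ≤ T := by linarith
      exact_mod_cast this
    refine ⟨i, ?_⟩
    rw [← hn.2 i hiT, dist_comm]
    exact hd.trans (le_max_right _ _)
  · obtain ⟨n, hn, hn'⟩ := (hc t).exists
    obtain ⟨j, -, hd⟩ := h1 b n (hqn n) (g n) (len n) (hg n) t hn
    refine ⟨j, ?_⟩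
    rw [← hn' t le_rfl]
    exact hd.trans (le_max_left _ _)

theorem isometry_natCast_int : Isometry (fun n : ℕ => (n : ℤ)) :=
  Isometry.of_dist_eq fun i j => by simp [Int.dist_eq, Nat.dist_eq]

theorem isometry_neg_natCast_int : Isometry (fun n : ℕ => -(n : ℤ)) :=
  Isometry.of_dist_eq fun i j => by
    simp only [Int.dist_eq, Nat.dist_eq]
    push_cast
    rw [abs_sub_comm]
    congr 1
    ring

/-- The two ends of a quasigeodesic line have bounded Gromov products, so they are distinct. -/
theorem IsQIEmbedding.ends_ne (hX : IsHyperbolic X) {α : ℤ → X} (hα : IsQIEmbedding α)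
    {ξ η : Boundary X} (hξ : Tendsto (fun n : ℕ => pt (α (-(n : ℤ)))) atTop (𝓝 (bdry ξ)))
    (hη : Tendsto (fun n : ℕ => pt (α n)) atTop (𝓝 (bdry η))) : ξ ≠ η := by
  rintro rfl
  obtain ⟨D, hD⟩ := hX.exists_fourPoint
  obtain ⟨k, hk, hq⟩ := isQIEmbedding_iff.1 hα
  obtain ⟨R, hR, h⟩ := exists_quasiGeodesic_near_geodesic hX hk
  obtain ⟨n, hn⟩ := (hD.eventually_le_gromovProduct hξ hη (α 0) (R + 1)).exists
  obtain ⟨c, m, hc⟩ := exists_geodesic (α (-(n : ℤ))) (α n)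
  obtain ⟨i, hi, hd⟩ := h (fun j : ℕ => α (-(n : ℤ) + j)) (2 * n) (fun i _ j _ => by
      have := hq (-(n : ℤ) + i) (-(n : ℤ) + j)
      rwa [Int.dist_eq, show ((-(n : ℤ) + i : ℤ) : ℝ) - ((-(n : ℤ) + j : ℤ) : ℝ) = (i : ℝ) - j by
        push_cast; ring] at this) c m (by
      convert hc using 2
      · simp
      · push_cast; ring) n (by omega)
  have := hc.gromovProduct_le hi (α 0)
  simp only [neg_add_cancel] at hd
  linarith

end Quasigeodesics

/-! ### Cannon–Thurston maps -/

section CTMaps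

variable {X : Type u} {Y : Type v} {Z : Type w} [MetricSpace X] [MetricSpace Y] [MetricSpace Z]

open Compactification

theorem IsCTMap.comp {g : Y → Z} {f : X → Y} {G : Boundary Y → Boundary Z}
    {F : Boundary X → Boundary Y} (hg : IsCTMap g G) (hf : IsCTMap f F) :
    IsCTMap (g ∘ f) (G ∘ F) :=
  ⟨hg.1.comp hf.1, fun ξ y hy => hg.2 _ _ (hf.2 ξ y hy)⟩

/-- A quasi-isometric embedding distorts Gromov products at most linearly, as geodesics of the
target stay close to images of geodesics. -/
theorem IsQIEmbedding.gromovProduct_le [ProperGeodesic X] [ProperGeodesic Y]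
    (hX : IsHyperbolic X) {f : Y → X} (hf : IsQIEmbedding f) :
    ∃ a b : ℝ, 0 ≤ a ∧ ∀ o y y' : Y,
      gromovProduct o y y' ≤ a * gromovProduct (f o) (f y) (f y') + b := by
  obtain ⟨k, hk, hq⟩ := isQIEmbedding_iff.1 hf
  obtain ⟨R, hR, h⟩ := exists_geodesic_near_quasiGeodesic hX hk
  obtain ⟨δ, hδ⟩ := hX.exists_thinTriangles
  refine ⟨k, k * (2 * δ + 1 + R) + k, by linarith, fun o y y' => ?_⟩
  obtain ⟨c, n, hc⟩ := exists_geodesic y y'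
  obtain ⟨e, m, he⟩ := exists_geodesic (f y) (f y')
  obtain ⟨i, hi, hd⟩ := hδ.exists_dist_le_gromovProduct he (f o)
  obtain ⟨j, hj, hd'⟩ := h (f ∘ c) n (fun i hi j hj => by
    have := hq (c i) (c j)
    rwa [hc.2.2 i hi j hj] at this) e m (by
      simp only [Function.comp, hc.1, hc.2.1]
      exact he) i hi
  have h1 := hc.gromovProduct_le hj o
  have h2 := (hq (c j) o).1
  have h3 := dist_triangle (f (c j)) (e i) (f o)
  rw [dist_comm (f (c j)) (e i)] at h3
  have h4 : dist (f (c j)) (f o) ≤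
    gromovProduct (f o) (f y) (f y') + (2 * δ + 1 + R) := by simp only [Function.comp] at hd'; linarith
  have h5 : k * dist (f (c j)) (f o) ≤
    k * (gromovProduct (f o) (f y) (f y') + (2 * δ + 1 + R)) := by gcongr
  linarith

theorem IsQIEmbedding.admitsCTMap [ProperGeodesic X] [ProperGeodesic Y] (hX : IsHyperbolic X)
    (hY : IsHyperbolic Y) {f : Y → X} (hf : IsQIEmbedding f) : AdmitsCTMap f := by
  obtain ⟨D, hD⟩ := hX.exists_fourPoint
  obtain ⟨E, hE⟩ := hY.exists_fourPoint
  obtain ⟨a, b, ha, hab⟩ := hf.gromovProduct_le hX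
  have hlarge : ∀ r o y y', (a * r + b) < gromovProduct o y y' →
      r ≤ gromovProduct (f o) (f y) (f y') := fun r o y y' h => by
    by_contra hlt
    have : a * gromovProduct (f o) (f y) (f y') ≤ a * r :=
      mul_le_mul_of_nonneg_left (not_le.1 hlt).le ha
    linarith [hab o y y']
  have hex : ∀ ξ : Boundary Y, ∃ η : Boundary X, ∃ c : GeodesicRay Y, c.endpoint = ξ ∧
      Tendsto (fun n => pt (f (c.1 n))) atTop (𝓝 (bdry η)) := fun ξ => by
    obtain ⟨c, rfl⟩ := ξ.exists_rep
    have hq := hf.comp_isometry c.2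
    obtain ⟨η, hη⟩ := hq.exists_endsAt hX
    exact ⟨η, c, rfl, hD.tendsto_of_near_ray hη hq.tendsto_dist⟩
  choose F c hc hF using hex
  refine ⟨F, ?_, fun ξ y hy => ?_⟩
  · refine continuous_induced_rng.2 (continuous_iff_continuousAt.2 fun ξ => ?_)
    let o := (c ξ).1 0
    have hb : (𝓝 ξ).HasBasis (fun _ : ℝ => True)
        (fun r => Compactification.bdry ⁻¹' basicNhd o r ξ) := by
      rw [nhds_induced]
      exact (hE.nhds_hasBasis o ξ).comap _
    refine (hb.tendsto_iff (hD.nhds_hasBasis (f o) (F ξ))).2 fun r _ => ?_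
    refine ⟨a * (r + 2 * D) + b + 1 + 2 * E, trivial, fun η hη => ?_⟩
    obtain ⟨N, hN⟩ := hE.forall_of_bdry_mem (c := c ξ) (c' := c η) (by
      rw [hc, hc]; exact hη)
    obtain ⟨d, hd⟩ := (F ξ).exists_rep
    obtain ⟨d', hd'⟩ := (F η).exists_rep
    have t := hF ξ
    have t' := hF η
    rw [← hd] at t
    rw [← hd'] at t'
    obtain ⟨i, hi, hiN⟩ := (((hD.tendsto_pt_iff (f o)).1 t (r + 2 * D)).and
      (eventually_ge_atTop N)).exists
    obtain ⟨j, hj, hjN⟩ := (((hD.tendsto_pt_iff (f o)).1 t' (r + 2 * D)).and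
      (eventually_ge_atTop N)).exists
    obtain ⟨M, hM⟩ := eventually_atTop.1 (hi.and hj)
    have hmid := hlarge (r + 2 * D) o _ _ (by linarith [hN i hiN j hjN])
    simp only [Function.comp]
    rw [← hd, ← hd']
    refine bdry_mem_basicNhd_of_forall (N := M) fun p hp q hq => ?_
    have h1 := hD.2 _ _ _ _ _ (hM p hp).1 hmid
    have h2 := (hM q hq).2
    rw [gromovProduct_comm] at h2
    have h3 := hD.2 _ _ _ _ _ h1 ((by linarith [hD.1] : r + 2 * D - D ≤ r + 2 * D).trans h2)
    linarith
  · let o := (c ξ).1 0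
    obtain ⟨d, hd⟩ := (F ξ).exists_rep
    have t := hF ξ
    rw [← hd] at t ⊢
    rw [← hc ξ] at hy
    refine (hD.tendsto_pt_iff (f o)).2 fun r => ?_
    filter_upwards [(hE.tendsto_pt_iff o).1 hy (a * (r + D) + b + 1)] with n hn
    obtain ⟨i, hi, hi'⟩ := (hn.and ((hD.tendsto_pt_iff (f o)).1 t (r + D))).exists
    filter_upwards [hi'] with j hj
    have := hD.2 _ _ _ _ _ hj (hlarge (r + D) o _ _ (by linarith))
    linarith

/-- If `y n` leaves every ball, the limit of `f (y n)` is in the image of the Cannon–Thurston map: by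
compactness a subsequence of `y` converges in `∂Y`. -/
theorem IsCTMap.exists_of_tendsto [ProperGeodesic X] [ProperGeodesic Y] (hX : IsHyperbolic X)
    (hY : IsHyperbolic Y) {f : Y → X} {F : Boundary Y → Boundary X} (hF : IsCTMap f F)
    {ξ : Boundary X} {y : ℕ → Y} {o : Y} (hy : Tendsto (fun n => dist o (y n)) atTop atTop)
    (h : Tendsto (fun n => pt (f (y n))) atTop (𝓝 (bdry ξ))) : ∃ η, F η = ξ := by
  obtain ⟨D, hD⟩ := hX.exists_fourPoint
  obtain ⟨E, hE⟩ := hY.exists_fourPoint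
  obtain ⟨η, φ, hφ, ht⟩ := hE.exists_tendsto_subseq hy
  exact ⟨η, hD.tendsto_unique (hF.2 η _ ht) (h.comp hφ)⟩

end CTMaps

/-! ### Word metrics and homomorphisms -/

section Cayley

variable {G : Type u} {H : Type v} [Group G] [Group H] {S : FiniteGeneratingSet G}
  {T : FiniteGeneratingSet H}

/-- The vertex of the Cayley graph given by a group element. -/
abbrev Cay.of (S : FiniteGeneratingSet G) (g : G) : Cay S := g

/-- The group element given by a vertex of the Cayley graph. -/
abbrev Cay.val (x : Cay S) : G := x

theorem dist_le_mul_of_step {X : Type u} [MetricSpace X] {p : ℕ → X} {n : ℕ} {L : ℝ}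
    (hp : ∀ i < n, dist (p i) (p (i + 1)) ≤ L) {i j : ℕ} (hij : i ≤ j) (hj : j ≤ n) :
    dist (p i) (p j) ≤ L * (j - i) := by
  induction j, hij using Nat.le_induction with
  | base => simp
  | succ j hij ih =>
    have h1 := ih (by omega)
    have h2 := hp j (by omega)
    have := dist_triangle (p i) (p j) (p (j + 1))
    push_cast
    linarith

/-- A path whose length is the distance of its end points is a geodesic. -/
theorem isGeodesic_of_step {X : Type u} [MetricSpace X] {p : ℕ → X} {n : ℕ}
    (hp : ∀ i < n, dist (p i) (p (i + 1)) ≤ 1) (hn : dist (p 0) (p n) = n) :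
    IsGeodesic p n (p 0) (p n) := by
  have key : ∀ i j, i ≤ j → j ≤ n → dist (p i) (p j) = j - i := fun i j hij hj => by
    have h1 := dist_le_mul_of_step hp hij hj
    have h2 := dist_le_mul_of_step hp (Nat.zero_le i) (hij.trans hj)
    have h3 := dist_le_mul_of_step hp hj le_rfl
    have := dist_triangle4 (p 0) (p i) (p j) (p n)
    push_cast at h2
    linarith
  refine ⟨rfl, rfl, fun i hi j hj => ?_⟩
  rcases le_total i j with h | h
  · have : (i : ℝ) ≤ j := by exact_mod_cast h
    rw [key i j h hj, abs_sub_comm, abs_of_nonneg (by linarith)]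
  · have : (j : ℝ) ≤ i := by exact_mod_cast h
    rw [dist_comm, key j i h hi, abs_of_nonneg (by linarith)]

theorem Cay.dist_le_one_iff {x y : Cay S} : dist x y ≤ 1 ↔ x = y ∨ (Cay.graph S).Adj x y := by
  have h : dist x y = ((Cay.graph S).dist x y : ℝ) := rfl
  rw [h, Nat.cast_le_one, Nat.le_one_iff_eq_zero_or_eq_one,
    (Cay.graph_connected S).dist_eq_zero_iff, SimpleGraph.dist_eq_one_iff_adj]

theorem Cay.exists_isGeodesic (x y : Cay S) : ∃ (c : ℕ → Cay S) (n : ℕ), IsGeodesic c n x y := by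
  obtain ⟨p, hp⟩ := (Cay.graph_connected S).exists_walk_length_eq_dist x y
  refine ⟨p.getVert, p.length, ?_⟩
  have h := isGeodesic_of_step (p := p.getVert) (n := p.length)
    (fun i hi => Cay.dist_le_one_iff.2 (Or.inr (p.adj_getVert_succ hi))) (by
      rw [p.getVert_zero, p.getVert_length, hp]
      rfl)
  rwa [p.getVert_zero, p.getVert_length] at h

theorem Cay.dist_mul_left (g x y : G) :
    dist (Cay.of S (g * x)) (Cay.of S (g * y)) = dist (Cay.of S x) (Cay.of S y) := by
  have key : ∀ g x y : G,
      dist (Cay.of S (g * x)) (Cay.of S (g * y)) ≤ dist (Cay.of S x) (Cay.of S y) := by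
    intro g x y
    obtain ⟨c, n, hc⟩ := Cay.exists_isGeodesic (Cay.of S x) (Cay.of S y)
    have hstep : ∀ i < n, dist (Cay.of S (g * (c i).val)) (Cay.of S (g * (c (i + 1)).val)) ≤ 1 := by
      intro i hi
      have h1 : dist (c i) (c (i + 1)) ≤ 1 := hc.dist_transition hi.le hi (Or.inr rfl)
      rcases Cay.dist_le_one_iff.1 h1 with h | h
      · rw [h, dist_self]
        exact zero_le_one
      · exact Cay.dist_le_one_iff.2 (Or.inr ((SimpleGraph.mulCayley_adj_mul_iff_right (M := G)).2 h))
    have := dist_le_mul_of_step (p := fun i => Cay.of S (g * (c i).val)) hstep (Nat.zero_le n) le_rfl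
    simp only [hc.1, hc.2.1] at this
    rw [hc.dist_eq]
    simpa using this
  refine le_antisymm (key g x y) ?_
  have := key g⁻¹ (g * x) (g * y)
  rwa [inv_mul_cancel_left, inv_mul_cancel_left] at this

theorem Cay.dist_eq_one_left (x y : G) :
    dist (Cay.of S x) (Cay.of S y) = dist (Cay.of S 1) (Cay.of S (x⁻¹ * y)) := by
  rw [← Cay.dist_mul_left x⁻¹ x y, inv_mul_cancel]

instance : ProperGeodesic (Cay S) where
  exists_geodesic := Cay.exists_isGeodesic
  finite_closedBall x r := by
    have h1 : ∀ z : Cay S, {y | dist z y ≤ 1}.Finite := fun z => by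
      refine (((finite_singleton z.val).union
        (S.carrier.finite_toSet.image fun s => z.val * s)).union
        (S.carrier.finite_toSet.image fun s => z.val * s⁻¹)).subset fun y hy => ?_
      rcases Cay.dist_le_one_iff.1 hy with h | h
      · exact Or.inl (Or.inl h.symm)
      · obtain ⟨-, s, hs, h | h⟩ := (SimpleGraph.mulCayley_adj' (M := G) _ _ _).1 h
        · exact Or.inl (Or.inr ⟨s, hs, h⟩)
        · exact Or.inr ⟨s, hs, by simp only [h]; exact mul_inv_cancel_right (G := G) y s⟩
    have h2 : ∀ n : ℕ, {y | dist x y ≤ n}.Finite := fun n => by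
      induction n with
      | zero =>
        refine (finite_singleton x).subset fun y hy => ?_
        simp only [Nat.cast_zero, mem_ofPred_eq] at hy
        exact (dist_le_zero.1 hy).symm
      | succ n ih =>
        refine (ih.biUnion fun z _ => h1 z).subset fun y hy => ?_
        obtain ⟨c, m, hc⟩ := Cay.exists_isGeodesic x y
        have hm : m ≤ n + 1 := by
          rw [mem_ofPred_eq, hc.dist_eq] at hy
          exact_mod_cast hy
        refine mem_biUnion (x := c (m - 1)) ?_ ?_
        · rw [mem_ofPred_eq, hc.dist_left (Nat.sub_le _ _)]
          exact_mod_cast (by omega)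
        · have := hc.dist_transition (Nat.sub_le m 1) le_rfl (by omega)
          rwa [hc.2.1] at this
    obtain ⟨n, hn⟩ := exists_nat_ge r
    refine (h2 n).subset fun y hy => ?_
    rw [Metric.mem_closedBall, dist_comm] at hy
    exact hy.trans hn

theorem Cay.finite_setOf_dist_one_le (S : FiniteGeneratingSet G) (R : ℝ) :
    {g : G | dist (Cay.of S 1) (Cay.of S g) ≤ R}.Finite := by
  refine (finite_closedBall (Cay.of S 1) R).subset fun g hg => ?_
  rw [Metric.mem_closedBall, dist_comm]
  exact hg

theorem exists_forall_dist_map_le (f : H →* G) (T : FiniteGeneratingSet H)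
    (S : FiniteGeneratingSet G) (R : ℝ) : ∃ L : ℝ, ∀ x y : H,
      dist (Cay.of T x) (Cay.of T y) ≤ R → dist (Cay.of S (f x)) (Cay.of S (f y)) ≤ L := by
  obtain ⟨L, hL⟩ := ((Cay.finite_setOf_dist_one_le T R).image
    fun h => dist (Cay.of S 1) (Cay.of S (f h))).bddAbove
  refine ⟨L, fun x y h => ?_⟩
  rw [Cay.dist_eq_one_left] at h ⊢
  rw [← map_inv, ← map_mul]
  exact hL ⟨_, h, rfl⟩

theorem exists_forall_dist_le_of_map {f : H →* G} (hf : Function.Injective f)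
    (T : FiniteGeneratingSet H) (S : FiniteGeneratingSet G) (R : ℝ) : ∃ L : ℝ, ∀ x y : H,
      dist (Cay.of S (f x)) (Cay.of S (f y)) ≤ R → dist (Cay.of T x) (Cay.of T y) ≤ L := by
  obtain ⟨L, hL⟩ := (((Cay.finite_setOf_dist_one_le S R).preimage hf.injOn).image
    fun h => dist (Cay.of T 1) (Cay.of T h)).bddAbove
  refine ⟨L, fun x y h => ?_⟩
  rw [Cay.dist_eq_one_left] at h ⊢
  rw [← map_inv, ← map_mul] at h
  exact hL ⟨_, h, rfl⟩

theorem exists_forall_dist_map_le_mul (f : H →* G) (T : FiniteGeneratingSet H)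
    (S : FiniteGeneratingSet G) : ∃ L : ℝ, 0 ≤ L ∧ ∀ x y : H,
      dist (Cay.of S (f x)) (Cay.of S (f y)) ≤ L * dist (Cay.of T x) (Cay.of T y) := by
  obtain ⟨L, hL⟩ := exists_forall_dist_map_le f T S 1
  refine ⟨L, dist_nonneg.trans (hL 1 1 (by rw [dist_self]; exact zero_le_one)), fun x y => ?_⟩
  obtain ⟨c, n, hc⟩ := exists_geodesic (Cay.of T x) (Cay.of T y)
  have := dist_le_mul_of_step (p := fun i => Cay.of S (f (c i))) (n := n) (L := L)
    (fun i hi => hL _ _ (hc.dist_transition hi.le hi (Or.inr rfl))) (Nat.zero_le n) le_rfl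
  simp only [hc.1, hc.2.1] at this
  rw [hc.dist_eq]
  simpa using this

/-- An affine bound for the distortion function makes an injective homomorphism a quasi-isometric
embedding. -/
theorem isDistorted_of_not_isQIEmbedding {f : H →* G} (hf : Function.Injective f)
    (h : ¬ IsQIEmbedding (Cay.map f T S)) : IsDistorted f T S := by
  by_contra hd
  unfold IsDistorted at hd
  push Not at hd
  obtain ⟨C, hC⟩ := hd
  obtain ⟨L, -, hL⟩ := exists_forall_dist_map_le_mul f T S
  refine h (isQIEmbedding_of_bounds (a := C) (b := C) (c := L) (d := 0) (fun x y => ?_)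
    (fun x y => by rw [add_zero]; exact hL x y))
  let R : ℕ := (Cay.graph S).dist (Cay.map f T S x) (Cay.map f T S y)
  have hR : dist (Cay.map f T S x) (Cay.map f T S y) = R := rfl
  have hfin : {z : Cay T | dist (Cay.map f T S z) ((1 : G) : Cay S) ≤ R}.Finite := by
    refine ((Cay.finite_setOf_dist_one_le S R).preimage hf.injOn).subset fun z hz => ?_
    have hz' : dist (Cay.map f T S z) (Cay.of S 1) ≤ R := hz
    rwa [dist_comm] at hz'
  rw [hR]
  refine le_trans ?_ (hC R)
  have h1 := Cay.dist_eq_one_left (S := T) x y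
  refine h1.le.trans (Metric.dist_le_diam_of_mem hfin.isBounded ?_ ?_)
  · change dist (Cay.of S (f 1)) (Cay.of S 1) ≤ R
    rw [map_one, dist_self]
    exact Nat.cast_nonneg _
  · change dist (Cay.of S (f ((Cay.val x)⁻¹ * Cay.val y))) (Cay.of S 1) ≤ R
    rw [dist_comm, map_mul, map_inv, ← Cay.dist_eq_one_left]
    exact hR.le

/-! ### Limit sets and the index of subgroups -/

/-- A geodesic line through a vertex of an infinite Cayley graph, as the limit of geodesic segments
that are translated so as to have their midpoints there. -/
theorem Cay.exists_line [Infinite G] (S : FiniteGeneratingSet G) (g : G) :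
    ∃ ℓ : ℤ → Cay S, Isometry ℓ ∧ ℓ 0 = Cay.of S g := by
  have hfar : ∀ n : ℕ, ∃ (c : ℕ → Cay S) (m : ℕ) (x y : Cay S), IsGeodesic c m x y ∧ 2 * n ≤ m := by
    intro n
    obtain ⟨x, hx⟩ := (Cay.finite_setOf_dist_one_le S (2 * n)).exists_notMem
    obtain ⟨c, m, hc⟩ := exists_geodesic (Cay.of S 1) (Cay.of S x)
    refine ⟨c, m, _, _, hc, ?_⟩
    rw [mem_ofPred_eq, hc.dist_eq, not_le] at hx
    exact_mod_cast hx.le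
  choose c m x y hc hm using hfar
  let f : ℕ → ℤ → G := fun n i => g * (c n n).val⁻¹ * (c n (n + i).toNat).val
  have hf : ∀ (i j : ℤ) (n : ℕ), i.natAbs ≤ n → j.natAbs ≤ n →
      dist (Cay.of S (f n i)) (Cay.of S (f n j)) = |(i : ℝ) - j| := by
    intro i j n hi hj
    have hmn := hm n
    have e1 := Cay.dist_mul_left (S := S) (g * (c n n).val⁻¹) (c n (n + i).toNat).val
      (c n (n + j).toNat).val
    refine e1.trans (((hc n).2.2 _ (by omega) _ (by omega)).trans ?_)
    rw [show (((n + i).toNat : ℕ) : ℝ) = (((n + i).toNat : ℤ) : ℝ) from (Int.cast_natCast _).symm,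
      show (((n + j).toNat : ℕ) : ℝ) = (((n + j).toNat : ℤ) : ℝ) from (Int.cast_natCast _).symm,
      Int.toNat_of_nonneg (by omega), Int.toNat_of_nonneg (by omega)]
    push_cast
    congr 1
    ring
  have hf0 : ∀ n, f n 0 = g := fun n => by simp [f]
  have hev : ∀ k : ℕ, ∀ᶠ n in hyperfilter ℕ, k ≤ n := fun k =>
    (eventually_ge_atTop k).filter_mono Nat.hyperfilter_le_atTop
  obtain ⟨ℓ, hℓ⟩ := exists_ultralimit (α := Cay S) (hyperfilter ℕ) f fun i =>
    ⟨Metric.closedBall (Cay.of S g) |(i : ℝ)|, finite_closedBall _ _, by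
      filter_upwards [hev i.natAbs] with n hn
      have := hf i 0 n hn (Nat.zero_le _)
      rw [hf0, Int.cast_zero, sub_zero] at this
      exact this.le⟩
  refine ⟨ℓ, Isometry.of_dist_eq fun i j => ?_, ?_⟩
  · obtain ⟨n, hi, hj, hin, hjn⟩ :=
      ((hℓ i).and ((hℓ j).and ((hev i.natAbs).and (hev j.natAbs)))).exists
    rw [← hi, ← hj, Int.dist_eq]
    exact hf i j n hin hjn
  · obtain ⟨n, hn⟩ := (hℓ 0).exists
    rw [← hn]
    exact hf0 n

/-- If the limit set of a quasi-isometrically embedded subgroup is the whole boundary, then every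
`g` is close to the subgroup: a geodesic line through `g` joins two points of the limit set. -/
theorem exists_forall_dist_le_of_limitSet_eq_univ [Infinite G] (hG : IsHyperbolic (Cay S))
    {f : H →* G} (hf : IsQIEmbedding (Cay.map f T S))
    (hlim : limitSet (range (Cay.map f T S)) = univ) :
    ∃ R : ℝ, ∀ g : G, ∃ h : H, dist (Cay.of S g) (Cay.of S (f h)) ≤ R := by
  obtain ⟨D, hD⟩ := hG.exists_fourPoint
  obtain ⟨a, b, ha, hab⟩ := hf.gromovProduct_le hG
  obtain ⟨δ, hδ⟩ := hG.exists_thinTriangles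
  obtain ⟨k, hk, hq⟩ := isQIEmbedding_iff.1 hf
  obtain ⟨R, hR, hnear⟩ := exists_geodesic_near_quasiGeodesic hG hk
  refine ⟨2 * D + 1 + (2 * δ + 1) + R, fun g => ?_⟩
  obtain ⟨ℓ, hℓ, hℓ0⟩ := Cay.exists_line S g
  let c₁ : GeodesicRay (Cay S) := ⟨_, hℓ.comp isometry_natCast_int⟩
  let c₂ : GeodesicRay (Cay S) := ⟨_, hℓ.comp isometry_neg_natCast_int⟩
  have hopp : ∀ i j : ℕ, gromovProduct (Cay.of S g) (c₁.1 i) (c₂.1 j) = 0 := fun i j => by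
    simp only [c₁, c₂, gromovProduct, Function.comp, ← hℓ0, hℓ.dist_eq, Int.dist_eq]
    push_cast
    rw [sub_zero, sub_zero, abs_neg, sub_neg_eq_add, Nat.abs_cast, Nat.abs_cast,
      abs_of_nonneg (by positivity)]
    ring
  have hpt : ∀ c : GeodesicRay (Cay S), ∃ h : Cay T, ∀ᶠ i in atTop,
      2 * D + 1 ≤ gromovProduct (Cay.of S g) (c.1 i) (Cay.map f T S h) := fun c => by
    have hc : c.endpoint ∈ limitSet (range (Cay.map f T S)) := by rw [hlim]; exact mem_univ _
    obtain ⟨x, hx, ht⟩ := hD.mem_limitSet_iff.1 hc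
    obtain ⟨n, hn⟩ := ((hD.tendsto_pt_iff (Cay.of S g)).1 ht (2 * D + 1)).exists
    obtain ⟨h, hh⟩ := hx n
    exact ⟨h, by rwa [hh]⟩
  obtain ⟨h₁, hh₁⟩ := hpt c₁
  obtain ⟨h₂, hh₂⟩ := hpt c₂
  obtain ⟨i, hi, hi'⟩ := (hh₁.and hh₂).exists
  have hprod : gromovProduct (Cay.of S g) (Cay.map f T S h₁) (Cay.map f T S h₂) < 2 * D + 1 := by
    by_contra hlt
    have h1 := hD.2 _ _ _ _ _ hi (not_lt.1 hlt)
    rw [gromovProduct_comm] at hi'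
    have h2 := hD.2 _ _ _ _ (2 * D + 1 - D) h1 (by linarith [hD.1])
    rw [hopp] at h2
    linarith
  obtain ⟨c, n, hc⟩ := exists_geodesic h₁ h₂
  obtain ⟨e, m, he⟩ := exists_geodesic (Cay.map f T S h₁) (Cay.map f T S h₂)
  obtain ⟨p, hp, hd⟩ := hδ.exists_dist_le_gromovProduct he (Cay.of S g)
  obtain ⟨j, hj, hd'⟩ := hnear (Cay.map f T S ∘ c) n (fun i hi j hj => by
    have := hq (c i) (c j)
    rwa [hc.2.2 i hi j hj] at this) e m (by
      simp only [Function.comp, hc.1, hc.2.1]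
      exact he) p hp
  refine ⟨c j, ?_⟩
  have h3 := dist_triangle (Cay.of S g) (e p) (Cay.map f T S (c j))
  rw [dist_comm (Cay.of S g) (e p)] at h3
  change dist (Cay.of S g) (Cay.map f T S (c j)) ≤ _
  simp only [Function.comp] at hd'
  linarith

theorem index_ne_zero_of_forall_dist_le {A : Subgroup G} {R : ℝ}
    (h : ∀ g : G, ∃ a ∈ A, dist (Cay.of S g) (Cay.of S a) ≤ R) : A.index ≠ 0 := by
  have hfin := Cay.finite_setOf_dist_one_le S R
  have : Finite (G ⧸ A) := by
    refine Set.finite_univ_iff.1 ((hfin.image fun b => ((b⁻¹ : G) : G ⧸ A)).subset fun q _ => ?_)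
    obtain ⟨g, rfl⟩ := QuotientGroup.mk_surjective q
    obtain ⟨a, ha, hd⟩ := h g⁻¹
    refine ⟨a⁻¹ * g⁻¹, ?_, ?_⟩
    · rw [mem_ofPred_eq, ← Cay.dist_eq_one_left, dist_comm]
      exact hd
    · refine QuotientGroup.eq.2 ?_
      simpa [mul_assoc] using A.inv_mem ha
  exact Subgroup.index_ne_zero_of_finite

theorem exists_forall_dist_le_of_index_ne_zero (S : FiniteGeneratingSet G) {A : Subgroup G}
    (h : A.index ≠ 0) : ∃ R : ℝ, ∀ g : G, ∃ a ∈ A, dist (Cay.of S g) (Cay.of S a) ≤ R := by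
  have : A.FiniteIndex := ⟨h⟩
  have : Finite (G ⧸ A) := Subgroup.finite_quotient_of_finiteIndex
  obtain ⟨R, hR⟩ := (Set.finite_range fun q : G ⧸ A =>
    dist (Cay.of S (q.out⁻¹)) (Cay.of S 1)).bddAbove
  refine ⟨R, fun g => ?_⟩
  obtain ⟨a, ha⟩ := QuotientGroup.mk_out_eq_mul A g⁻¹
  refine ⟨a, a.2, ?_⟩
  have := hR ⟨_, rfl⟩ (a := dist (Cay.of S ((g⁻¹ : G) : G ⧸ A).out⁻¹) (Cay.of S 1))
  rw [ha, ← Cay.dist_mul_left (a : G)] at this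
  simpa using this

theorem limitSet_eq_univ_of_index_ne_zero (hG : IsHyperbolic (Cay S)) {A : Subgroup G}
    (h : A.index ≠ 0) : limitSet (Cay.subset S (A : Set G)) = univ := by
  obtain ⟨D, hD⟩ := hG.exists_fourPoint
  obtain ⟨R, hR⟩ := exists_forall_dist_le_of_index_ne_zero S h
  choose p hp hd using hR
  refine eq_univ_of_forall fun ξ => ?_
  obtain ⟨c, rfl⟩ := ξ.exists_rep
  exact hD.mem_limitSet_iff.2 ⟨fun n => p (c.1 n), fun n => hp _,
    hD.tendsto_of_dist_le (hD.tendsto_ray c) (fun n => hd _)⟩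

end Cayley

open Compactification

/-! ### Subgroups carrying quasigeodesic lines -/

section Carrying

variable {G : Type u} {H : Type v} [Group G] [Group H]

/-- Suppose that `f : H → G` admits a Cannon–Thurston map and that the limit set of `f(H)` is `∂G`.
Then the Cannon–Thurston map is onto, so it takes a set with full limit set in `∂H` to one with full
limit set in `∂G`. -/
theorem limitSet_eq_univ_of_admitsCTMap {S : FiniteGeneratingSet G} {T : FiniteGeneratingSet H}
    (hG : IsHyperbolic (Cay S)) (hH : IsHyperbolic (Cay T)) {f : H →* G}
    (hf : AdmitsCTMap (Cay.map f T S)) (hfull : limitSet (range (Cay.map f T S)) = univ)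
    {A : Set (Cay T)} (hA : limitSet A = univ) {B : Set (Cay S)}
    (hAB : ∀ a ∈ A, Cay.map f T S a ∈ B) : limitSet B = univ := by
  obtain ⟨D, hD⟩ := hG.exists_fourPoint
  obtain ⟨E, hE⟩ := hH.exists_fourPoint
  obtain ⟨F, hF⟩ := hf
  obtain ⟨L, hL0, hL⟩ := exists_forall_dist_map_le_mul f T S
  refine eq_univ_of_forall fun ξ => ?_
  obtain ⟨a, ha, hξ⟩ := hD.mem_limitSet_iff.1 (by rw [hfull]; exact mem_univ ξ)
  choose y hy using ha
  have hya : Tendsto (fun n => dist (Cay.of T 1) (y n)) atTop atTop := by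
    refine tendsto_atTop.2 fun r => ?_
    filter_upwards [(hD.tendsto_dist hξ (Cay.of S (f 1))).eventually_ge_atTop (L * r + 1)]
      with n hn
    rw [← hy n] at hn
    by_contra hlt
    have h1 : dist (Cay.of S (f 1)) (Cay.map f T S (y n)) ≤ L * dist (Cay.of T 1) (y n) :=
      hL 1 (y n).val
    have h2 := mul_le_mul_of_nonneg_left (not_le.1 hlt).le hL0
    linarith
  simp only [← hy] at hξ
  obtain ⟨η, rfl⟩ := hF.exists_of_tendsto hG hH hya hξ
  obtain ⟨b, hb, hη⟩ := hE.mem_limitSet_iff.1 (by rw [hA]; exact mem_univ η)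
  exact hD.mem_limitSet_iff.2 ⟨_, fun n => hAB _ (hb n), hF.2 η b hη⟩

/-- A sequence in a subgroup that stays close to a quasigeodesic line is itself a quasigeodesic
line in the word metric of the subgroup. -/
theorem isQIEmbedding_of_dist_le {S : FiniteGeneratingSet G} {T : FiniteGeneratingSet H}
    {f : H →* G} (hf : Function.Injective f) {α : ℤ → Cay S} (hα : IsQIEmbedding α) {u : ℤ → H}
    {M : ℝ} (hM : ∀ n, dist (α n) (Cay.of S (f (u n))) ≤ M) :
    IsQIEmbedding (fun n => Cay.of T (u n)) := by
  obtain ⟨k, hk, hq⟩ := isQIEmbedding_iff.1 hα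
  obtain ⟨C, hC0, hC⟩ := exists_forall_dist_map_le_mul f T S
  obtain ⟨L, hL⟩ := exists_forall_dist_le_of_map hf T S (2 * M + 2 * k)
  have hstep : ∀ n, dist (Cay.of T (u n)) (Cay.of T (u (n + 1))) ≤ L := fun n => by
    refine hL _ _ ?_
    have h1 := (hq n (n + 1)).2
    rw [Int.dist_eq] at h1
    push_cast at h1
    rw [show (n : ℝ) - (n + 1) = -1 by ring, abs_neg, abs_one] at h1
    have h2 := dist_triangle4 (Cay.of S (f (u n))) (α n) (α (n + 1)) (Cay.of S (f (u (n + 1))))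
    have h3 := hM n
    have h4 := hM (n + 1)
    rw [dist_comm] at h3
    linarith
  have hle : ∀ n m : ℤ, n ≤ m →
      dist (Cay.of T (u n)) (Cay.of T (u m)) ≤ L * dist n m := fun n m hnm => by
    obtain ⟨j, rfl⟩ := Int.le.dest hnm
    have h := dist_le_mul_of_step (p := fun i : ℕ => Cay.of T (u (n + i))) (n := j) (L := L)
      (fun i _ => by
        have := hstep (n + i)
        rwa [add_assoc] at this) (Nat.zero_le j) le_rfl
    simp only [Nat.cast_zero, add_zero, sub_zero] at h
    rw [Int.dist_eq]
    push_cast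
    rw [sub_add_cancel_left, abs_neg, Nat.abs_cast]
    exact h
  refine isQIEmbedding_of_bounds (a := k * C) (b := k * (2 * M) + k) (c := L) (d := 0)
    (fun n m => ?_) (fun n m => ?_)
  · have h1 := (hq n m).1
    have h2 := dist_triangle4 (α n) (Cay.of S (f (u n))) (Cay.of S (f (u m))) (α m)
    have h3 := hM n
    have h4 := hM m
    rw [dist_comm] at h4
    have h5 := hC (u n) (u m)
    have h6 : k * dist (α n) (α m) ≤
        k * (C * dist (Cay.of T (u n)) (Cay.of T (u m)) + 2 * M) := by
      gcongr
      linarith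
    linarith
  · rw [add_zero]
    rcases le_total n m with h | h
    · exact hle n m h
    · rw [dist_comm, dist_comm n]
      exact hle m n h

/-- A line `α` in `H` that stays close to `K` in `G` stays close to a finitely generated subgroup of
`H ⊓ K`. Indeed if `α n * t` and `α m * t` are in `K`, then `α n * (α m)⁻¹` is in `H ⊓ K`, and only
finitely many `t` are needed. -/
theorem exists_fg_subgroup_near {G : Type u} [Group G] {H K : Subgroup G}
    {S : FiniteGeneratingSet G} {SH : FiniteGeneratingSet H} {α : ℤ → Cay SH}
    (hα : IsQIEmbedding α)
    (hK : LiesNear (Cay.map H.subtype SH S ∘ α) (Cay.subset S (K : Set G))) :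
    ∃ (K₁ : Subgroup G) (h₁ : K₁ ≤ H) (_ : K₁ ≤ K), K₁.FG ∧ ∃ (u : ℤ → K₁) (M : ℝ),
      ∀ n, dist (α n) (Cay.of SH (Subgroup.inclusion h₁ (u n))) ≤ M := by
  obtain ⟨D, hD⟩ := hK
  choose a ha hd using hD
  obtain ⟨k, hk, hq⟩ := isQIEmbedding_iff.1 hα
  let τ : ℤ → G := fun n => ((α n).val : G)⁻¹ * (a n).val
  have hτ : (range τ).Finite := by
    refine (Cay.finite_setOf_dist_one_le S D).subset ?_
    rintro _ ⟨n, rfl⟩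
    rw [mem_ofPred_eq, ← Cay.dist_eq_one_left]
    exact hd n
  -- `ρ n` is a representative of the class of the `m` with `τ m = τ n`
  let ρ : ℤ → ℤ := fun n => Function.invFun τ (τ n)
  have hρ : ∀ n, τ (ρ n) = τ n := fun n => Function.invFun_eq ⟨n, rfl⟩
  have hρfin : (range ρ).Finite := by
    refine (hτ.image (Function.invFun τ)).subset ?_
    rintro _ ⟨n, rfl⟩
    exact ⟨τ n, mem_range_self n, rfl⟩
  let v : ℤ → H := fun n => (α n).val * (α (ρ n)).val⁻¹
  have hvK : ∀ n, (v n : G) ∈ K := fun n => by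
    have e : (v n : G) = (a n).val * (a (ρ n)).val⁻¹ := by
      have e1 := hρ n
      simp only [τ] at e1
      have e2 : (a (ρ n)).val = ((α (ρ n)).val : G) * (((α n).val : G)⁻¹ * (a n).val) := by
        rw [← e1, mul_inv_cancel_left]
      rw [e2]
      simp [v, mul_assoc]
    rw [e]
    exact K.mul_mem (ha n) (K.inv_mem (ha (ρ n)))
  obtain ⟨M, hM⟩ := (hρfin.image fun m =>
    dist (Cay.of SH 1) (Cay.of SH (α m).val⁻¹)).bddAbove
  have hvα : ∀ n, dist (α n) (Cay.of SH (v n)) ≤ M := fun n => by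
    have h := hM ⟨ρ n, mem_range_self n, rfl⟩
    simp only at h
    rw [← Cay.dist_mul_left (α n).val, mul_one] at h
    exact h
  have hstep : ∀ n, dist (Cay.of SH 1) (Cay.of SH ((v n)⁻¹ * v (n + 1))) ≤ 2 * M + 2 * k := by
    intro n
    rw [← Cay.dist_eq_one_left]
    have h1 := (hq n (n + 1)).2
    rw [Int.dist_eq] at h1
    push_cast at h1
    rw [show (n : ℝ) - (n + 1) = -1 by ring, abs_neg, abs_one] at h1
    have h2 := dist_triangle4 (Cay.of SH (v n)) (α n) (α (n + 1)) (Cay.of SH (v (n + 1)))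
    have h3 := hvα n
    rw [dist_comm] at h3
    linarith [hvα (n + 1)]
  let r : ℝ := max (2 * M + 2 * k) (dist (Cay.of SH 1) (Cay.of SH (v 0)))
  let B : Set G := H.subtype '' {x | dist (Cay.of SH 1) (Cay.of SH x) ≤ r ∧ (x : G) ∈ K}
  have hBH : Subgroup.closure B ≤ H := by
    rw [Subgroup.closure_le]
    rintro _ ⟨x, -, rfl⟩
    exact x.2
  have hBK : Subgroup.closure B ≤ K := by
    rw [Subgroup.closure_le]
    rintro _ ⟨x, hx, rfl⟩
    exact hx.2
  have hB : ∀ n, (v n : G)⁻¹ * (v (n + 1) : G) ∈ Subgroup.closure B := fun n =>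
    Subgroup.subset_closure ⟨(v n)⁻¹ * v (n + 1), ⟨(hstep n).trans (le_max_left _ _),
      K.mul_mem (K.inv_mem (hvK n)) (hvK (n + 1))⟩, rfl⟩
  have hv : ∀ n, (v n : G) ∈ Subgroup.closure B := fun n => by
    induction n using Int.induction_on with
    | zero => exact Subgroup.subset_closure ⟨v 0, ⟨le_max_right _ _, hvK 0⟩, rfl⟩
    | succ n ih =>
      have := Subgroup.mul_mem _ ih (hB n)
      rwa [mul_inv_cancel_left] at this
    | pred n ih =>
      have := Subgroup.mul_mem _ ih (Subgroup.inv_mem _ (hB (-n - 1)))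
      rwa [sub_add_cancel, mul_inv_rev, inv_inv, mul_inv_cancel_left] at this
  refine ⟨Subgroup.closure B, hBH, hBK, (Subgroup.fg_iff _).2 ⟨B, rfl, ?_⟩,
    fun n => ⟨v n, hv n⟩, M, hvα⟩
  exact ((Cay.finite_setOf_dist_one_le SH r).subset fun x hx => hx.1).image _

end Carrying

end CT

open CT in
theorem corollary3p17 {G : Type*} [Group G] (G₁ H K : Subgroup G) (hH : H ≤ G₁) (hK : K ≤ G₁)
    (S : FiniteGeneratingSet G) (S₁ : FiniteGeneratingSet G₁)
    (SH : FiniteGeneratingSet H) (SK : FiniteGeneratingSet K)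
    (hypG : IsHyperbolic (Cay S)) (hypG₁ : IsHyperbolic (Cay S₁))
    (hypH : IsHyperbolic (Cay SH)) (hypK : IsHyperbolic (Cay SK))
    (ctG₁ : AdmitsCTMap (Cay.map G₁.subtype S₁ S))
    (ctK : AdmitsCTMap (Cay.map (Subgroup.inclusion hK) SK S₁))
    (limK : limitSet (Cay.subset S₁ (K.subgroupOf G₁ : Set G₁)) = univ)
    (qiH : IsQIEmbedding (Cay.map (Subgroup.inclusion hH) SH S₁))
    (indexH : H.relIndex G₁ = 0)
    (nqiH : ¬ IsQIEmbedding (Cay.map H.subtype SH S)) :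
    AdmitsCTMap (Cay.map H.subtype SH S) ∧
    ∀ α : ℤ → Cay SH, IsLeaf (Cay.map H.subtype SH S) α →
      LiesNear (Cay.map H.subtype SH S ∘ α) (Cay.subset S (K : Set G)) →
      ∃ (K₁ : Subgroup G) (_ : K₁ ≤ H) (hK₁ : K₁ ≤ K), K₁.FG ∧
        -- (1)
        LiesNear (Cay.map H.subtype SH S ∘ α) (Cay.subset S (K₁ : Set G)) ∧
        -- (2)
        limitSet (Cay.subset SK (K₁.subgroupOf K : Set K)) ≠ univ ∧
        K₁.relIndex K = 0 ∧
        -- (3)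
        (∀ T : FiniteGeneratingSet K₁,
          ¬ IsQIEmbedding (Cay.map K₁.subtype T S) ∧ IsDistorted K₁.subtype T S) ∧
        -- (4)
        (∀ T : FiniteGeneratingSet K₁,
          IsQIEmbedding (Cay.map (Subgroup.inclusion hK₁) T SK) →
            ∃ β : ℤ → Cay SK, IsLeaf (Cay.map K.subtype SK S) β ∧
              LiesNear β (Cay.subset SK (K₁.subgroupOf K : Set K))) := by
  obtain ⟨F₁, hF₁⟩ := ctG₁
  refine ⟨?_, fun α hα hnear => ?_⟩
  · obtain ⟨F, hF⟩ := qiH.admitsCTMap hypG₁ hypH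
    exact ⟨_, hF₁.comp hF⟩
  obtain ⟨F, hF, hαqi, ⟨p, q⟩, ⟨hpq, hFpq⟩, hp, hq⟩ := hα
  simp only at hpq hFpq hp hq
  obtain ⟨K₁, h₁, h₂, hfg, u, M, hM⟩ := exists_fg_subgroup_near hαqi hnear
  obtain ⟨D, hD⟩ := hypG.exists_fourPoint
  obtain ⟨DH, hDH⟩ := hypH.exists_fourPoint
  obtain ⟨DK, hDK⟩ := hypK.exists_fourPoint
  obtain ⟨L, hL⟩ := exists_forall_dist_map_le H.subtype SH S M
  have hLu : ∀ n, dist (Cay.map H.subtype SH S (α n)) (Cay.of S (u n : G)) ≤ L := fun n =>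
    hL _ _ (hM n)
  have huqi : ∀ T : FiniteGeneratingSet K₁, IsQIEmbedding (fun n => Cay.of T (u n)) := fun T =>
    isQIEmbedding_of_dist_le (Subgroup.inclusion_injective h₁) hαqi hM
  -- in `G`, both ends of `u` converge to the common image of the ends of the leaf
  have hneg : Tendsto (fun n : ℕ => Compactification.pt (Cay.of S (u (-(n : ℤ)) : G))) atTop
      (𝓝 (Compactification.bdry (F p))) :=
    hD.tendsto_of_dist_le (hF.2 p _ (hDH.tendsto_of_near_ray hp
      (hαqi.comp_isometry isometry_neg_natCast_int).tendsto_dist)) fun n => hLu _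
  have hpos : Tendsto (fun n : ℕ => Compactification.pt (Cay.of S (u n : G))) atTop
      (𝓝 (Compactification.bdry (F p))) := by
    rw [hFpq]
    exact hD.tendsto_of_dist_le (hF.2 q _ (hDH.tendsto_of_near_ray hq
      (hαqi.comp_isometry isometry_natCast_int).tendsto_dist)) fun n => hLu _
  have hlim : limitSet (Cay.subset SK (K₁.subgroupOf K : Set K)) ≠ univ := by
    intro hfull
    have hinf : Infinite G₁ := by
      by_contra hfin
      rw [not_infinite_iff_finite] at hfin
      exact Subgroup.index_ne_zero_of_finite (H := H.subgroupOf G₁) indexH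
    have hKrange : range (Cay.map (Subgroup.inclusion hK) SK S₁) =
        Cay.subset S₁ (K.subgroupOf G₁ : Set G₁) :=
      Set.ext fun x => ⟨by rintro ⟨y, rfl⟩; exact y.2, fun hx => ⟨⟨_, hx⟩, rfl⟩⟩
    have hHfull : limitSet (range (Cay.map (Subgroup.inclusion hH) SH S₁)) = univ :=
      limitSet_eq_univ_of_admitsCTMap hypG₁ hypK ctK (by rw [hKrange, limK]) hfull
        fun a ha => ⟨⟨_, h₁ ha⟩, rfl⟩
    obtain ⟨R, hR⟩ := exists_forall_dist_le_of_limitSet_eq_univ hypG₁ qiH hHfull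
    refine index_ne_zero_of_forall_dist_le (S := S₁) (A := H.subgroupOf G₁) (R := R) (fun g => ?_)
      indexH
    obtain ⟨h, hh⟩ := hR g
    exact ⟨_, h.2, hh⟩
  refine ⟨K₁, h₁, h₂, hfg, ⟨L, fun n => ⟨_, (u n).2, hLu n⟩⟩, hlim, ?_, fun T => ?_, fun T hT => ?_⟩
  · by_contra hne
    exact hlim (limitSet_eq_univ_of_index_ne_zero hypK hne)
  · have hnot : ¬ IsQIEmbedding (Cay.map K₁.subtype T S) := fun hqi =>
      (hqi.comp (huqi T)).ends_ne hypG hneg hpos rfl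
    exact ⟨hnot, isDistorted_of_not_isQIEmbedding K₁.subtype_injective hnot⟩
  · obtain ⟨FK, hFK⟩ := ctK
    have hβ := hT.comp (huqi T)
    have hCT := hF₁.comp hFK
    have hβneg := hβ.comp_isometry isometry_neg_natCast_int
    have hβpos := hβ.comp_isometry isometry_natCast_int
    obtain ⟨ξ, hξ⟩ := hβneg.exists_endsAt hypK
    obtain ⟨η, hη⟩ := hβpos.exists_endsAt hypK
    have tξ := hDK.tendsto_of_near_ray hξ hβneg.tendsto_dist
    have tη := hDK.tendsto_of_near_ray hη hβpos.tendsto_dist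
    refine ⟨_, ⟨F₁ ∘ FK, hCT, hβ, (ξ, η), ⟨hβ.ends_ne hypK tξ tη, ?_⟩, hξ, hη⟩,
      0, fun n => ⟨_, (u n).2, (dist_self _).le⟩⟩
    exact (hD.tendsto_unique (hCT.2 ξ _ tξ) hneg).trans
      (hD.tendsto_unique (hCT.2 η _ tη) hpos).symm
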